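/- Let $(\mathcal A,\varphi)$ be a $C^*$-noncommutative probability space ($\mathcal A$ a unital $C^*$-algebra, $\varphi$ a state). For $a,b\in\mathcal A$ put $$G_a(z)=\varphi\big((z-a)^{-1}\big),\qquad G_{(a,b)}(z,w)=\varphi\big((z-a)^{-1}(w-b)^{-1}\big).$$ The $R$-transform $R_a$ is the analytic function near $0\in\mathbb C$ such that, with $K_a(z)=\frac1z+R_a(z)$, one has $G_a(K_a(z))=z$ for all small $z\neq0$. The partial bi-free $R$-transform of $(a,b)$ is the analytic function near $(0,0)\in\mathbb C^2$ with $$R_{(a,b)}(z,w)=1+zR_a(z)+wR_b(w)-\frac{zw}{G_{(a,b)}(K_a(z),K_b(w))}\qquad(z,w\ne0\text{ small}).$$ For $X\in M_2(\mathcal A)$ put $G_X(v)=(\varphi\otimes\mathrm{Id}_{M_2(\mathbb C)})\big[(v-X)^{-1}\big]$ for those $v\in M_2(\mathbb C)$ for which $v-X$ is invertible. The $M_2(\mathbb C)$-valued $R$-transform $R_X$ on a connected open neighbourhood $\Omega$ of $0$ in $M_2(\mathbb C)$ is the analytic function on $\Omega$ such that, for every invertible $v\in\Omega$, $v^{-1}+R_X(v)-X$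 is invertible and $G_X(v^{-1}+R_X(v))=v$. Below, $\Omega$ is always required to contain, for some $\delta>0$, all matrices $\begin{bmatrix}z&\zeta\\0&w\end{bmatrix}$ with $|z|,|w|<\delta$, $\zeta\in\mathbb C$. 1. Let $a,b\in\mathcal A$ and $X=\begin{bmatrix}a&0\\0&b\end{bmatrix}\in M_2(\mathcal A)$. Then $R_a$, $R_b$, $R_{(a,b)}$ exist, $R_X$ exists on some such $\Omega$, and for any such $\Omega$ there is $\varepsilon>0$ such that $$R_X\left(\begin{bmatrix}z&\zeta\\0&w\end{bmatrix}\right)=\begin{bmatrix}R_a(z)&\frac{\zeta}{zw}\big(R_{(a,b)}(z,w)-zR_a(z)-wR_b(w)\big)\\0&R_b(w)\end{bmatrix}$$ for all $z,w\in\mathbb C\setminus\{0\}$ with $|z|,|w|<\varepsilon$ and all $\zeta\in\mathbb C$. 2. Let the two-faced pairs $(a_1,b_1),(a_2,b_2)\in\mathcal A^2$ be bi-free with respect to $\varphi$, i.e. there are complex vector spaces $\mathcal X_j=\mathbb C\xi_j\oplus\ker\psi_j$ with linear functionals $\psi_j$, $\psi_j(\xi_j)=1$, and linear operators $S_j,T_j$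 on $\mathcal X_j$ ($j=1,2$), such that the joint distribution (all mixed moments) of $a_1,a_2,b_1,b_2$ with respect to $\varphi$ equals that of $\lambda_1(S_1),\lambda_2(S_2),\rho_1(T_1),\rho_2(T_2)$ with respect to the vacuum state $T\mapsto\psi(T\xi)$, where $\lambda_j$ and $\rho_j$ are the left and right representations of $\mathcal L(\mathcal X_j)$ on the free product $(\mathcal X,\ker\psi,\xi)=(\mathcal X_1,\ker\psi_1,\xi_1)*(\mathcal X_2,\ker\psi_2,\xi_2)$. Put $X_j=\begin{bmatrix}a_j&0\\0&b_j\end{bmatrix}$. Then there is $\varepsilon>0$ such that $$R_{X_1+X_2}\left(\begin{bmatrix}z&\zeta\\0&w\end{bmatrix}\right)=R_{X_1}\left(\begin{bmatrix}z&\zeta\\0&w\end{bmatrix}\right)+R_{X_2}\left(\begin{bmatrix}z&\zeta\\0&w\end{bmatrix}\right)$$ for all $z,w\in\mathbb C$ with $|z|,|w|<\varepsilon$ and all $\zeta\in\mathbb C$. -/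

import Mathlib

open scoped TensorProduct Topology ComplexOrder

attribute [local instance] Matrix.normedAddCommGroup Matrix.normedSpace

universe u v

noncomputable section

namespace BiFreeProb

/-! ### Vector spaces with a distinguished state vector and their free product -/

/-- A complex vector space `X = ℂ ξ ⊕ ker ψ` with a distinguished state vector `ξ`, where
`ψ` is a linear functional with `ψ ξ = 1`. -/
structure PointedSpace where
  carrier : Type v
  [addCommGroup : AddCommGroup carrier]
  [module : Module ℂ carrier]
  ξ : carrier
  ψ : carrier →ₗ[ℂ] ℂ
  ψ_ξ : ψ ξ = 1

attribute [instance] PointedSpace.addCommGroup PointedSpace.module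

namespace PointedSpace

/-- The kernel of the distinguished functional. -/
abbrev Ker (X : PointedSpace.{v}) : Submodule ℂ X.carrier := LinearMap.ker X.ψ

/-- The projection `x ↦ x - ψ(x) ξ` of `X = ℂ ξ ⊕ ker ψ` onto `ker ψ`. -/
def toKer (X : PointedSpace.{v}) : X.carrier →ₗ[ℂ] X.Ker :=
  LinearMap.codRestrict X.Ker (LinearMap.id - X.ψ.smulRight X.ξ) (fun x => by
    simp [X.ψ_ξ])

/-- The vector state `φ_ξ(T) = ψ(T ξ)` on the linear operators of `X`. -/
def vectorState (X : PointedSpace.{v}) (T : Module.End ℂ X.carrier) : ℂ := X.ψ (T X.ξ)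

end PointedSpace

/-- The full tensor algebra over `ker ψ₁ ⊕ ker ψ₂`. The free product space is the subspace of
alternating tensors in it, see `altTensors`. -/
abbrev FullFock (E : Fin 2 → PointedSpace.{v}) : Type v :=
  TensorAlgebra ℂ (∀ i, (E i).Ker)

section FullFock

variable (E : Fin 2 → PointedSpace.{v})

/-- The one-letter tensor given by a vector of `ker ψ_i`. -/
def letter (i : Fin 2) : (E i).Ker →ₗ[ℂ] FullFock E :=
  TensorAlgebra.ι ℂ ∘ₗ LinearMap.single ℂ (fun i => (E i).Ker) i

/-- The vacuum functional: the coefficient of the empty tensor. -/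
def vacuum : FullFock E →ₗ[ℂ] ℂ := (TensorAlgebra.algebraMapInv).toLinearMap

variable {E}

/-- Auxiliary to `headElim`: the tensor algebra acts on pairs by
`h • (t, s) = (h ⊗ t, F h t)`. -/
def headAux (F : (∀ i, (E i).Ker) →ₗ[ℂ] FullFock E →ₗ[ℂ] FullFock E) :
    FullFock E →ₐ[ℂ] Module.End ℂ (FullFock E × FullFock E) :=
  TensorAlgebra.lift ℂ
    { toFun := fun h =>
        ((LinearMap.mul ℂ (FullFock E) (TensorAlgebra.ι ℂ h)).prod (F h)) ∘ₗ
          LinearMap.fst ℂ (FullFock E) (FullFock E)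
      map_add' := fun x y => by ext <;> simp
      map_smul' := fun c x => by ext <;> simp }

/-- The linear map sending the empty tensor `1` to `c` and `h ⊗ t` to `F h t`
(see `headElim_one`, `headElim_ι_mul`). -/
def headElim (c : FullFock E) (F : (∀ i, (E i).Ker) →ₗ[ℂ] FullFock E →ₗ[ℂ] FullFock E) :
    FullFock E →ₗ[ℂ] FullFock E :=
  LinearMap.snd ℂ _ _ ∘ₗ LinearMap.applyₗ ((1, c) : FullFock E × FullFock E) ∘ₗ
    (headAux F).toLinearMap

theorem headAux_ι (F : (∀ i, (E i).Ker) →ₗ[ℂ] FullFock E →ₗ[ℂ] FullFock E)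
    (h : ∀ i, (E i).Ker) (p : FullFock E × FullFock E) :
    headAux F (TensorAlgebra.ι ℂ h) p = (TensorAlgebra.ι ℂ h * p.1, F h p.1) := by
  simp [headAux]

theorem headAux_fst (F : (∀ i, (E i).Ker) →ₗ[ℂ] FullFock E →ₗ[ℂ] FullFock E)
    (t : FullFock E) (p : FullFock E × FullFock E) : (headAux F t p).1 = t * p.1 := by
  induction t using TensorAlgebra.induction generalizing p with
  | algebraMap r => simp [Module.algebraMap_end_apply, Algebra.smul_def]
  | ι x => simp [headAux_ι]
  | mul a b ha hb => simp [ha, hb, mul_assoc]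
  | add a b ha hb => simp [ha, hb, add_mul]

theorem headElim_one (c : FullFock E)
    (F : (∀ i, (E i).Ker) →ₗ[ℂ] FullFock E →ₗ[ℂ] FullFock E) : headElim c F 1 = c := by
  simp [headElim]

theorem headElim_ι_mul (c : FullFock E)
    (F : (∀ i, (E i).Ker) →ₗ[ℂ] FullFock E →ₗ[ℂ] FullFock E) (h : ∀ i, (E i).Ker)
    (t : FullFock E) : headElim c F (TensorAlgebra.ι ℂ h * t) = F h t := by
  simp [headElim, headAux_ι, headAux_fst]

variable (E)

/-- `insert i x t = ψ_i(x) t + (x - ψ_i(x) ξ_i) ⊗ t`. On tensors `t` that do not begin with a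
letter from `ker ψ_i` this is the standard identification `V_i` of `X_i ⊗ X(ℓ, i)` with `X`. -/
def insert (i : Fin 2) : (E i).carrier →ₗ[ℂ] FullFock E →ₗ[ℂ] FullFock E :=
  (E i).ψ.smulRight LinearMap.id +
    LinearMap.mul ℂ (FullFock E) ∘ₗ letter E i ∘ₗ (E i).toKer

/-- The operator acting by `T` on the first tensor factor, if that factor is from `ker ψ_i`, and
on an additional factor `ξ_i` in front of the tensor, otherwise:
`1 ↦ insert i (T ξ_i) 1`, and, for `h = h_i + h_j` with `h_i ∈ ker ψ_i`, `h_j ∈ ker ψ_j`, `j ≠ i`,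
`h ⊗ t ↦ insert i (T h_i) t + insert i (T ξ_i) (h_j ⊗ t)`. -/
def leftOp (i : Fin 2) (T : Module.End ℂ (E i).carrier) : Module.End ℂ (FullFock E) :=
  headElim (insert E i (T (E i).ξ) 1)
    (insert E i ∘ₗ T ∘ₗ (E i).Ker.subtype ∘ₗ LinearMap.proj i +
      (LinearMap.mul ℂ (FullFock E) ∘ₗ TensorAlgebra.ι ℂ ∘ₗ
        (LinearMap.id - LinearMap.single ℂ (fun i => (E i).Ker) i ∘ₗ LinearMap.proj i)).compr₂
          (insert E i (T (E i).ξ)))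

/-- The reversal `x₁ ⊗ ⋯ ⊗ xₙ ↦ xₙ ⊗ ⋯ ⊗ x₁`. -/
def reversal : FullFock E →ₗ[ℂ] FullFock E :=
  (MulOpposite.opLinearEquiv ℂ).symm.toLinearMap ∘ₗ
    (TensorAlgebra.lift ℂ
      ((MulOpposite.opLinearEquiv ℂ).toLinearMap ∘ₗ
        (TensorAlgebra.ι ℂ : (∀ i, (E i).Ker) →ₗ[ℂ] FullFock E))).toLinearMap

/-- The mirror image of `leftOp`: the operator `T` acts on the last tensor factor. -/
def rightOp (i : Fin 2) (T : Module.End ℂ (E i).carrier) : Module.End ℂ (FullFock E) :=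
  reversal E ∘ₗ leftOp E i T ∘ₗ reversal E

/-- The elementary tensor of a word in letters from `ker ψ₁` and `ker ψ₂`. -/
def wordTensor (l : List (Σ i, (E i).Ker)) : FullFock E :=
  (l.map (fun p => letter E p.1 p.2)).prod

/-- The alternating tensors: the subspace
`ℂ 1 ⊕ ⨁_{n ≥ 1} ⨁_{i₁ ≠ i₂ ≠ ⋯ ≠ iₙ} ker ψ_{i₁} ⊗ ⋯ ⊗ ker ψ_{iₙ}`. -/
def altTensors : Submodule ℂ (FullFock E) :=
  Submodule.span ℂ (wordTensor E '' {l | l.IsChain (fun p q => p.1 ≠ q.1)})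

variable {E}

theorem insert_apply (i : Fin 2) (x : (E i).carrier) (t : FullFock E) :
    insert E i x t = (E i).ψ x • t + letter E i ((E i).toKer x) * t := by
  simp [insert]

theorem leftOp_one (i : Fin 2) (T : Module.End ℂ (E i).carrier) :
    leftOp E i T 1 = insert E i (T (E i).ξ) 1 := headElim_one _ _

theorem leftOp_letter_mul (i : Fin 2) (T : Module.End ℂ (E i).carrier) (x : (E i).Ker)
    (t : FullFock E) : leftOp E i T (letter E i x * t) = insert E i (T x) t := by
  simp [leftOp, letter, headElim_ι_mul]

theorem leftOp_letter_mul_of_ne {i j : Fin 2} (hij : j ≠ i) (T : Module.End ℂ (E i).carrier)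
    (x : (E j).Ker) (t : FullFock E) :
    leftOp E i T (letter E j x * t) = insert E i (T (E i).ξ) (letter E j x * t) := by
  simp [leftOp, letter, headElim_ι_mul, Pi.single_eq_of_ne hij.symm]

theorem reversal_one : reversal E 1 = 1 := by
  simp [reversal]

theorem reversal_mul (s t : FullFock E) :
    reversal E (s * t) = reversal E t * reversal E s := by
  simp [reversal]

theorem reversal_letter (i : Fin 2) (x : (E i).Ker) :
    reversal E (letter E i x) = letter E i x := by
  simp [reversal, letter]

theorem reversal_wordTensor (l : List (Σ i, (E i).Ker)) :
    reversal E (wordTensor E l) = wordTensor E l.reverse := by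
  induction l with
  | nil => simp [wordTensor, reversal_one]
  | cons p l ih =>
    have h : wordTensor E (p :: l) = letter E p.1 p.2 * wordTensor E l := by simp [wordTensor]
    rw [h, reversal_mul, ih, reversal_letter]
    simp [wordTensor]

theorem wordTensor_mem {l : List (Σ i, (E i).Ker)} (hl : l.IsChain (fun p q => p.1 ≠ q.1)) :
    wordTensor E l ∈ altTensors E :=
  Submodule.subset_span ⟨l, hl, rfl⟩

theorem insert_mem (i : Fin 2) (x : (E i).carrier) {l : List (Σ i, (E i).Ker)}
    (hl : ∀ y : (E i).Ker, List.IsChain (fun p q => p.1 ≠ q.1) (⟨i, y⟩ :: l)) :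
    insert E i x (wordTensor E l) ∈ altTensors E := by
  rw [insert_apply]
  refine add_mem (Submodule.smul_mem _ _ (wordTensor_mem (hl 0).of_cons)) ?_
  have h := wordTensor_mem (hl ((E i).toKer x))
  simpa [wordTensor] using h

theorem leftOp_mem (i : Fin 2) (T : Module.End ℂ (E i).carrier) :
    ∀ t ∈ altTensors E, leftOp E i T t ∈ altTensors E := by
  intro t ht
  induction ht using Submodule.span_induction with
  | zero => simp
  | add s t _ _ hs ht => rw [map_add]; exact add_mem hs ht
  | smul c t _ ht => rw [map_smul]; exact Submodule.smul_mem _ _ ht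
  | mem t ht =>
    obtain ⟨l, hl, rfl⟩ := ht
    cases l with
    | nil =>
      have h : wordTensor E [] = 1 := rfl
      rw [h, leftOp_one, ← h]
      exact insert_mem i _ (fun y => by simp)
    | cons p l =>
      obtain ⟨j, y⟩ := p
      have h : wordTensor E (⟨j, y⟩ :: l) = letter E j y * wordTensor E l := by
        simp [wordTensor]
      by_cases hij : j = i
      · subst hij
        rw [h, leftOp_letter_mul]
        refine insert_mem j _ (fun z => ?_)
        cases l with
        | nil => simp
        | cons q l =>
          have hl' : List.IsChain (fun p q : Σ i, (E i).Ker => p.1 ≠ q.1)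
            (⟨j, y⟩ :: q :: l) := hl
          rw [List.isChain_cons_cons] at hl' ⊢
          exact hl'
      · rw [h, leftOp_letter_mul_of_ne hij, ← h]
        refine insert_mem i _ (fun z => ?_)
        rw [List.isChain_cons_cons]
        exact ⟨fun e => hij e.symm, hl⟩

theorem reversal_mem : ∀ t ∈ altTensors E, reversal E t ∈ altTensors E := by
  intro t ht
  induction ht using Submodule.span_induction with
  | zero => simp
  | add s t _ _ hs ht => rw [map_add]; exact add_mem hs ht
  | smul c t _ ht => rw [map_smul]; exact Submodule.smul_mem _ _ ht
  | mem t ht =>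
    obtain ⟨l, hl, rfl⟩ := ht
    rw [reversal_wordTensor]
    refine wordTensor_mem ?_
    rw [List.isChain_reverse]
    exact List.IsChain.imp (fun p q h => h.symm) hl

theorem rightOp_mem (i : Fin 2) (T : Module.End ℂ (E i).carrier) :
    ∀ t ∈ altTensors E, rightOp E i T t ∈ altTensors E :=
  fun t ht => reversal_mem _ (leftOp_mem i T _ (reversal_mem t ht))

variable (E)

/-- The free product `(X, ker ψ, ξ) = (X₁, ker ψ₁, ξ₁) * (X₂, ker ψ₂, ξ₂)` of vector spaces with
distinguished state vectors. -/
def freeProduct : PointedSpace.{v} where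
  carrier := altTensors E
  ξ := ⟨1, wordTensor_mem (l := []) List.isChain_nil⟩
  ψ := vacuum E ∘ₗ (altTensors E).subtype
  ψ_ξ := by simp [vacuum]

/-- The left representation `λ_i` of the operators of `X_i` on the free product. -/
def leftRep (i : Fin 2) (T : Module.End ℂ (E i).carrier) :
    Module.End ℂ (freeProduct E).carrier :=
  LinearMap.restrict (leftOp E i T) (leftOp_mem i T)

/-- The right representation `ρ_i` of the operators of `X_i` on the free product. -/
def rightRep (i : Fin 2) (T : Module.End ℂ (E i).carrier) :
    Module.End ℂ (freeProduct E).carrier :=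
  LinearMap.restrict (rightOp E i T) (rightOp_mem i T)

end FullFock

/-! ### Bi-freeness -/

section Transforms

variable {A : Type u} [CStarAlgebra A]

/-- `φ` is a state of the C*-algebra `A`. -/
structure IsState (φ : A →ₗ[ℂ] ℂ) : Prop where
  map_one : φ 1 = 1
  nonneg : ∀ x : A, 0 ≤ φ (star x * x)

/-- The two-faced pairs `(a 0, b 0)` and `(a 1, b 1)` are bi-free with respect to `φ`: for some
vector spaces `X_i` with distinguished state vectors and some operators `S_i, T_i` on `X_i`, the
joint distribution of `a 0, a 1, b 0, b 1` with respect to `φ` (all mixed moments) is that of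
`λ_0(S_0), λ_1(S_1), ρ_0(T_0), ρ_1(T_1)` with respect to the vector state of the free product. -/
def BiFree (φ : A →ₗ[ℂ] ℂ) (a b : Fin 2 → A) : Prop :=
  ∃ (E : Fin 2 → PointedSpace.{v}) (S T : ∀ i, Module.End ℂ (E i).carrier),
    ∀ m : List (Fin 2 ⊕ Fin 2),
      φ (m.map (Sum.elim a b)).prod =
        (freeProduct E).vectorState
          (m.map (Sum.elim (fun i => leftRep E i (S i)) (fun i => rightRep E i (T i)))).prod

/-! ### Analytic transforms -/

/-- The Cauchy transform `G_a(z) = φ((z - a)⁻¹)`, for `z` outside the spectrum of `a`. -/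
def cauchy (φ : A →ₗ[ℂ] ℂ) (a : A) (z : ℂ) : ℂ := φ (resolvent a z)

/-- The two-variable Cauchy transform `G_{(a,b)}(z,w) = φ((z - a)⁻¹ (w - b)⁻¹)`. -/
def biCauchy (φ : A →ₗ[ℂ] ℂ) (a b : A) (z w : ℂ) : ℂ := φ (resolvent a z * resolvent b w)

/-- `R` is (a representative of the germ at `0` of) the `R`-transform `R_a`: it is analytic at
`0`, and `K_a(z) = 1/z + R(z)` inverts `G_a`, near infinity. -/
structure IsRTransform (φ : A →ₗ[ℂ] ℂ) (a : A) (R : ℂ → ℂ) : Prop where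
  analyticAt : AnalyticAt ℂ R 0
  inverse : ∀ᶠ z in 𝓝[≠] (0 : ℂ),
    z⁻¹ + R z ∈ resolventSet ℂ a ∧ cauchy φ a (z⁻¹ + R z) = z

/-- `R` is (a representative of the germ at `(0,0)` of) the partial bi-free `R`-transform of the
pair `(a,b)`: with the one-variable `R`-transforms `Ra`, `Rb`, and `K_a(z) = 1/z + Ra(z)`,
`K_b(w) = 1/w + Rb(w)`, it is the analytic function near `(0,0)` with
`R(z,w) = 1 + z Ra(z) + w Rb(w) - z w / G_{(a,b)}(K_a(z), K_b(w))`. -/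
structure IsBiRTransform (φ : A →ₗ[ℂ] ℂ) (a b : A) (R : ℂ → ℂ → ℂ) : Prop where
  analyticAt : AnalyticAt ℂ (fun p : ℂ × ℂ => R p.1 p.2) (0, 0)
  formula : ∃ Ra Rb : ℂ → ℂ, IsRTransform φ a Ra ∧ IsRTransform φ b Rb ∧
    ∀ᶠ p in 𝓝 ((0, 0) : ℂ × ℂ), p.1 ≠ 0 → p.2 ≠ 0 →
      biCauchy φ a b (p.1⁻¹ + Ra p.1) (p.2⁻¹ + Rb p.2) ≠ 0 ∧
      R p.1 p.2 = 1 + p.1 * Ra p.1 + p.2 * Rb p.2 -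
        p.1 * p.2 / biCauchy φ a b (p.1⁻¹ + Ra p.1) (p.2⁻¹ + Rb p.2)

/-- `v - X` for `v ∈ M₂(ℂ)` and `X ∈ M₂(A)`. -/
def matSub (v : Matrix (Fin 2) (Fin 2) ℂ) (X : Matrix (Fin 2) (Fin 2) A) :
    Matrix (Fin 2) (Fin 2) A :=
  v.map (algebraMap ℂ A) - X

/-- The `M₂(ℂ)`-valued Cauchy transform `G_X(v) = (φ ⊗ id)((v - X)⁻¹)`, where `v - X` is
invertible. -/
def matCauchy (φ : A →ₗ[ℂ] ℂ) (X : Matrix (Fin 2) (Fin 2) A) (v : Matrix (Fin 2) (Fin 2) ℂ) :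
    Matrix (Fin 2) (Fin 2) ℂ :=
  (Ring.inverse (matSub v X)).map φ

/-- `R` is, on the connected open neighbourhood `Ω` of `0` in `M₂(ℂ)`, the `M₂(ℂ)`-valued
`R`-transform of `X`: it is analytic on `Ω`, and `G_X(v⁻¹ + R(v)) = v` for all invertible
`v ∈ Ω`. -/
structure IsMatRTransformOn (φ : A →ₗ[ℂ] ℂ) (X : Matrix (Fin 2) (Fin 2) A)
    (Ω : Set (Matrix (Fin 2) (Fin 2) ℂ))
    (R : Matrix (Fin 2) (Fin 2) ℂ → Matrix (Fin 2) (Fin 2) ℂ) : Prop where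
  isOpen : IsOpen Ω
  isPreconnected : IsPreconnected Ω
  zero_mem : 0 ∈ Ω
  analytic : AnalyticOnNhd ℂ R Ω
  inverse : ∀ v ∈ Ω, IsUnit v → IsUnit (matSub (v⁻¹ + R v) X) ∧ matCauchy φ X (v⁻¹ + R v) = v

/-- `Ω` contains all upper triangular matrices with sufficiently small diagonal entries. -/
def ContainsUpper (Ω : Set (Matrix (Fin 2) (Fin 2) ℂ)) : Prop :=
  ∃ δ > 0, ∀ z w ζ : ℂ, ‖z‖ < δ → ‖w‖ < δ → !![z, ζ; 0, w] ∈ Ω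

end Transforms

end BiFreeProb

end

noncomputable section

namespace BiFreeProb

open Filter

/-! ### Perturbations of the identity and local uniqueness of scalar R-transforms -/

section Local

variable {A : Type u} [CStarAlgebra A] {φ : A →ₗ[ℂ] ℂ}

/-! Formula for `R_X`. Let `v = [z ζ; 0 w]` and `X = diag(a, b)`. Eliminating blocks in `v⁻¹ + R -
X`, the lower-left entry of `G_X(v⁻¹ + R) = v` forces `R 1 0 = 0` for small data. The matrix is then
upper triangular: the diagonal entries of the equation are the scalar equations for `a` and `b`, and
the upper-right one gives `R 0 1 = ζ (1/(zw) - 1/G_{(a,b)})` (`entries_of_matCauchy_eq`). The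
resolvent identity makes the scalar solutions unique (`IsRTransform.eventuallyEq`), and the identity
theorem in `ζ` removes the smallness of `ζ` (`IsMatRTransformOn.upper`).

Existence. Scalar diagonal matrices commute with `X`, so conjugation by them suggests `R = [f, ζ g;
η h, k]` at `[z ζ; η w]`, with `f, g, h, k` depending only on `z`, `w` and `ζη`. The equation is
equivalent to one that is regular at `v = 0`, namely `φ((R - X)(1 + v(R - X))⁻¹) = 0`, and the
implicit function theorem solves it. Only `ζη` has to be small, so all of `ζ` is allowed when `η =
0`. The scalar and bi-free transforms are read off from entries of `R`.

Additivity. Mixed moments on a free product depend only on the moments of each pair, so both factors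
may be taken to be `(A, 1, φ)` with left multiplications (`BiFree.moment_eq`). Let `N i` and `1 + k
i` be the resolvents of `a i` and `b i` at `K_{a i}(z)` and `K_{b i}(w)`, normalised to expectation
`1`. The sum `Ω` of all alternating words in `k 0`, `k 1` satisfies `(K' - ρ(b 0) - ρ(b 1)) Ω = w⁻¹
1` with `K' = w⁻¹ + R_{b 0}(w) + R_{b 1}(w)`. Dually, the multiplicative functional `ℓ` with value
`φ(N i x)` on a letter `x` of index `i` satisfies `ℓ ∘ (K - λ(a 0) - λ(a 1)) = z⁻¹ vacuum`. So the
two-variable Cauchy transform of the sums is `zw ℓ(Ω)`. With `d i = φ(N i k i)`, a geometric series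
gives `ℓ(Ω) = (1 + d 0)(1 + d 1)/(1 - d 0 d 1)`, while the transform of each pair is `zw (1 + d i)`;
additivity is then an identity of rational functions (`BiFree.eventually_additive`). -/

theorem IsState.continuous (hφ : IsState φ) : Continuous φ := by
  -- For the spectral order the nonnegative elements are the `star s * s`, and positive functionals
  -- are automatically bounded.
  let _ := CStarAlgebra.spectralOrder A
  let _ := CStarAlgebra.spectralOrderedRing A
  have hpos : ∀ x : A, 0 ≤ x → 0 ≤ φ x := by
    intro x hx
    obtain ⟨s, rfl⟩ := CStarAlgebra.nonneg_iff_eq_star_mul_self.mp hx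
    exact hφ.nonneg s
  obtain ⟨C, hC⟩ := PositiveLinearMap.exists_norm_apply_le (PositiveLinearMap.mk₀ φ hpos)
  exact (LinearMap.mkContinuousOfExistsBound φ ⟨C, hC⟩).continuous

theorem eventually_isUnit_one_add :
    ∀ᶠ x in 𝓝 (0 : A), IsUnit (1 + x) := by
  have h : Tendsto (fun x : A => 1 + x) (𝓝 0) (𝓝 1) := by
    have : Continuous fun x : A => 1 + x := by fun_prop
    simpa using this.tendsto 0
  exact h.eventually (Units.isOpen.mem_nhds isUnit_one)

theorem tendsto_inverse_one_add :
    Tendsto (fun x : A => Ring.inverse (1 + x)) (𝓝 0) (𝓝 1) := by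
  have h : Tendsto (fun x : A => 1 + x) (𝓝 0) (𝓝 1) := by
    have : Continuous fun x : A => 1 + x := by fun_prop
    simpa using this.tendsto 0
  have h2 := (NormedRing.inverse_continuousAt (1 : Aˣ)).tendsto
  simp only [Units.val_one, Ring.inverse_one] at h2
  exact h2.comp h

/-- Inverses of small perturbations of `1` are close to `1`, so that the state does not vanish on
their products. -/
theorem eventually_apply_inverse_mul_ne_zero (hφ : IsState φ) {ι : Type*} {l : Filter ι}
    {x y : ι → A} (hx : Tendsto x l (𝓝 0)) (hy : Tendsto y l (𝓝 0)) :
    ∀ᶠ i in l, φ (Ring.inverse (1 + x i) * Ring.inverse (1 + y i)) ≠ 0 := by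
  have h1 := tendsto_inverse_one_add.comp hx
  have h2 := tendsto_inverse_one_add.comp hy
  have h3 := (hφ.continuous.tendsto _).comp (h1.mul h2)
  simp only [mul_one, hφ.map_one] at h3
  exact h3.eventually_ne one_ne_zero

/-- Rescaling by `z` turns points near infinity into small perturbations of `1`, the form in which
all estimates are made. -/
theorem inv_add_sub_eq {z : ℂ} (hz : z ≠ 0) (r : ℂ) (a : A) :
    algebraMap ℂ A (z⁻¹ + r) - a = z⁻¹ • (1 + z • (algebraMap ℂ A r - a)) := by
  rw [smul_add, smul_smul, inv_mul_cancel₀ hz, one_smul, map_add,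
    Algebra.algebraMap_eq_smul_one z⁻¹, add_sub_assoc]

theorem mem_resolventSet_inv_add {z : ℂ} (hz : z ≠ 0) {r : ℂ} {a : A} :
    z⁻¹ + r ∈ resolventSet ℂ a ↔ IsUnit (1 + z • (algebraMap ℂ A r - a)) := by
  rw [spectrum.mem_resolventSet_iff, inv_add_sub_eq hz]
  exact isUnit_smul_iff (Units.mk0 z⁻¹ (inv_ne_zero hz)) _

theorem resolvent_inv_add {z : ℂ} (hz : z ≠ 0) {r : ℂ} {a : A} :
    resolvent a (z⁻¹ + r) = z • Ring.inverse (1 + z • (algebraMap ℂ A r - a)) := by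
  rw [resolvent, inv_add_sub_eq hz]
  by_cases h : IsUnit (1 + z • (algebraMap ℂ A r - a))
  · obtain ⟨x, hx⟩ := h
    rw [← hx, Ring.inverse_unit]
    have hu : (z⁻¹ • (x : A)) = ((Units.mk0 z⁻¹ (inv_ne_zero hz) • x : Aˣ) : A) := rfl
    rw [hu, Ring.inverse_unit]
    refine Units.inv_eq_of_mul_eq_one_right ?_
    rw [← hu, smul_mul_smul_comm, inv_mul_cancel₀ hz, Units.mul_inv, one_smul]
  -- Outside the resolvent set both sides take the default value `0` of `Ring.inverse`.
  · rw [Ring.inverse_non_unit _ h, smul_zero, Ring.inverse_non_unit]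
    rwa [← inv_add_sub_eq hz, ← spectrum.mem_resolventSet_iff, mem_resolventSet_inv_add hz]

/-- Apply `φ` to the resolvent identity: the left side vanishes, and the right side is `s - r` times
`z²` times the nonzero number in `hne`. -/
theorem eq_of_cauchy_eq {a : A} {z r s : ℂ} (hz : z ≠ 0)
    (hr : z⁻¹ + r ∈ resolventSet ℂ a) (hs : z⁻¹ + s ∈ resolventSet ℂ a)
    (h : cauchy φ a (z⁻¹ + r) = cauchy φ a (z⁻¹ + s))
    (hne : φ (Ring.inverse (1 + z • (algebraMap ℂ A r - a)) *
      Ring.inverse (1 + z • (algebraMap ℂ A s - a))) ≠ 0) : r = s := by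
  have h1 : resolvent a (z⁻¹ + r) - resolvent a (z⁻¹ + s) =
      (s - r) • (resolvent a (z⁻¹ + r) * resolvent a (z⁻¹ + s)) := by
    rw [spectrum.mem_resolventSet_iff] at hr hs
    rw [resolvent, resolvent]
    obtain ⟨x, hx⟩ := hr
    obtain ⟨y, hy⟩ := hs
    rw [← hx, ← hy, Ring.inverse_unit, Ring.inverse_unit]
    have e : ((s - r) • (1 : A)) = y - x := by
      rw [hx, hy, sub_sub_sub_cancel_right, ← map_sub, Algebra.algebraMap_eq_smul_one]
      congr 1; ring
    calc ((x⁻¹ : Aˣ) : A) - (y⁻¹ : Aˣ) = (x⁻¹ : Aˣ) * ((y : A) - x) * (y⁻¹ : Aˣ) := by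
          rw [mul_sub, sub_mul, mul_assoc]; simp
      _ = _ := by rw [← e]; simp
  have h2 := congrArg φ h1
  rw [map_sub, map_smul] at h2
  rw [cauchy, cauchy] at h
  rw [h, sub_self, resolvent_inv_add hz, resolvent_inv_add hz] at h2
  simp only [smul_mul_smul_comm, map_smul, smul_eq_mul] at h2
  have : s - r = 0 := by
    by_contra hc
    exact (mul_ne_zero hc (mul_ne_zero (mul_ne_zero hz hz) hne)) h2.symm
  exact (sub_eq_zero.mp this).symm

theorem tendsto_smul_sub {ι : Type*} {l : Filter ι} {z r : ι → ℂ} {r₀ : ℂ}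
    (hz : Tendsto z l (𝓝 0)) (hr : Tendsto r l (𝓝 r₀)) (a : A) :
    Tendsto (fun i => z i • (algebraMap ℂ A (r i) - a)) l (𝓝 0) := by
  have h : Tendsto (fun i => algebraMap ℂ A (r i) - a) l (𝓝 (algebraMap ℂ A r₀ - a)) :=
    (((continuous_algebraMap ℂ A).tendsto _).comp hr).sub_const a
  simpa using hz.smul h

/-- Uniqueness of the R-transform. The general filter allows solutions that depend on further
parameters, such as the diagonal entries of a matrix R-transform. -/
theorem IsRTransform.eventuallyEq (hφ : IsState φ) {a : A} {ι : Type*} {l : Filter ι}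
    {R : ℂ → ℂ} (hR : IsRTransform φ a R) {z r : ι → ℂ} {r₀ : ℂ} (hz : Tendsto z l (𝓝[≠] 0))
    (hr : Tendsto r l (𝓝 r₀))
    (h : ∀ᶠ i in l, (z i)⁻¹ + r i ∈ resolventSet ℂ a ∧ cauchy φ a ((z i)⁻¹ + r i) = z i) :
    ∀ᶠ i in l, r i = R (z i) := by
  have hz0 : Tendsto z l (𝓝 0) := hz.mono_right nhdsWithin_le_nhds
  have h1 := hz.eventually hR.inverse
  have h2 := eventually_apply_inverse_mul_ne_zero hφ (tendsto_smul_sub hz0 hr a)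
    (tendsto_smul_sub hz0 (hR.analyticAt.continuousAt.tendsto.comp hz0) a)
  filter_upwards [h, h1, h2, hz.eventually self_mem_nhdsWithin] with i h h1 h2 h3
  exact eq_of_cauchy_eq h3 h.1 h1.1 (h.2.trans h1.2.symm) h2

end Local

end BiFreeProb

end
noncomputable section

namespace BiFreeProb

open Filter

/-! ### The matrix R-transform at small upper triangular matrices -/

section Triangular

variable {A : Type u} [CStarAlgebra A] {φ : A →ₗ[ℂ] ℂ}

theorem inv_upper {z w : ℂ} (hz : z ≠ 0) (hw : w ≠ 0) (ζ : ℂ) :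
    (!![z, ζ; 0, w] : Matrix (Fin 2) (Fin 2) ℂ)⁻¹ = !![z⁻¹, -(ζ / (z * w)); 0, w⁻¹] := by
  apply Matrix.inv_eq_right_inv
  ext i j
  fin_cases i <;> fin_cases j <;> simp [Matrix.mul_apply, hz, hw]
  field_simp
  ring

theorem isUnit_upper {z w : ℂ} (hz : z ≠ 0) (hw : w ≠ 0) (ζ : ℂ) :
    IsUnit (!![z, ζ; 0, w] : Matrix (Fin 2) (Fin 2) ℂ) := by
  rw [Matrix.isUnit_iff_isUnit_det, Matrix.det_fin_two_of]
  simp [hz, hw]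

/-- The entries of the `R`-transform of `diag(a, b)` at an upper triangular matrix, when that
matrix is small. -/
theorem entries_of_matCauchy_eq {a b : A} {z w ζ : ℂ} (hz : z ≠ 0) (hw : w ≠ 0)
    {R : Matrix (Fin 2) (Fin 2) ℂ}
    (hP : IsUnit (1 + z • (algebraMap ℂ A (R 0 0) - a)))
    (hQ : IsUnit (1 + w • (algebraMap ℂ A (R 1 1) - b)))
    (hV : IsUnit (1 + (z • (algebraMap ℂ A (R 0 0) - a) +
      ((ζ - z * w * R 0 1) * R 1 0) • Ring.inverse (1 + w • (algebraMap ℂ A (R 1 1) - b)))))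
    (hPQ : φ (Ring.inverse (1 + z • (algebraMap ℂ A (R 0 0) - a)) *
      Ring.inverse (1 + w • (algebraMap ℂ A (R 1 1) - b))) ≠ 0)
    (hQV : φ (Ring.inverse (1 + w • (algebraMap ℂ A (R 1 1) - b)) *
      Ring.inverse (1 + (z • (algebraMap ℂ A (R 0 0) - a) +
      ((ζ - z * w * R 0 1) * R 1 0) • Ring.inverse (1 + w • (algebraMap ℂ A (R 1 1) - b))))) ≠ 0)
    (hU : IsUnit (matSub ((!![z, ζ; 0, w])⁻¹ + R) !![a, 0; 0, b]))
    (hG : matCauchy φ !![a, 0; 0, b] ((!![z, ζ; 0, w])⁻¹ + R) = !![z, ζ; 0, w]) :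
    R 1 0 = 0 ∧ cauchy φ a (z⁻¹ + R 0 0) = z ∧ cauchy φ b (w⁻¹ + R 1 1) = w ∧
      biCauchy φ a b (z⁻¹ + R 0 0) (w⁻¹ + R 1 1) ≠ 0 ∧
      R 0 1 = ζ * (1 / (z * w) - 1 / biCauchy φ a b (z⁻¹ + R 0 0) (w⁻¹ + R 1 1)) := by
  rw [inv_upper hz hw] at hU hG
  rw [matCauchy] at hG
  set N := Ring.inverse (matSub (!![z⁻¹, -(ζ / (z * w)); 0, w⁻¹] + R) !![a, 0; 0, b]) with hN
  have hMN := Ring.mul_inverse_cancel _ hU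
  rw [← hN] at hMN
  have e00 := congrFun (congrFun hMN 0) 0
  have e01 := congrFun (congrFun hMN 0) 1
  have e10 := congrFun (congrFun hMN 1) 0
  have e11 := congrFun (congrFun hMN 1) 1
  have g00 := congrFun (congrFun hG 0) 0
  have g01 := congrFun (congrFun hG 0) 1
  have g10 := congrFun (congrFun hG 1) 0
  have g11 := congrFun (congrFun hG 1) 1
  simp only [matSub, Matrix.mul_apply, Fin.sum_univ_two, Matrix.sub_apply, Matrix.map_apply,
    Matrix.add_apply, Matrix.of_apply, Matrix.cons_val', Matrix.cons_val_zero, Matrix.cons_val_one,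
    Matrix.cons_val_fin_one, sub_zero, Matrix.one_apply, zero_add, inv_add_sub_eq hz,
    inv_add_sub_eq hw, ← Algebra.smul_def] at e00 e01 e10 e11 g00 g01 g10 g11
  generalize hα : 1 + z • (algebraMap ℂ A (R 0 0) - a) = P at *
  generalize hδ : 1 + w • (algebraMap ℂ A (R 1 1) - b) = D at *
  rw [← add_assoc, hα] at hV hQV
  simp only [if_true, smul_mul_assoc, Fin.isValue, one_ne_zero, zero_ne_one, if_false]
    at e00 e01 e10 e11
  -- The first column of the product is solved by elimination; `hV` is the invertibility of the
  -- resulting Schur complement.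
  have h10 : N 1 0 = -(w * R 1 0) • (Ring.inverse D * N 0 0) := by
    have h := congrArg (fun x => w • (Ring.inverse D * x)) e10
    simp only [mul_add, mul_smul_comm, mul_zero, smul_zero, smul_add, smul_smul, ← mul_assoc,
      Ring.inverse_mul_cancel _ hQ, one_mul, mul_inv_cancel₀ hw, one_smul] at h
    rw [neg_smul]
    exact eq_neg_of_add_eq_zero_right h
  have h00 : N 0 0 = z • Ring.inverse (P + ((ζ - z * w * R 0 1) * R 1 0) • Ring.inverse D) := by
    have h : (P + ((ζ - z * w * R 0 1) * R 1 0) • Ring.inverse D) * N 0 0 = z • 1 := by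
      rw [← e00, h10, add_mul, smul_add, smul_smul, smul_smul, mul_inv_cancel₀ hz, one_smul,
        smul_mul_assoc, smul_smul]
      congr 2
      field_simp
      ring
    have h' := congrArg
      (fun x => Ring.inverse (P + ((ζ - z * w * R 0 1) * R 1 0) • Ring.inverse D) * x) h
    simpa only [← mul_assoc, Ring.inverse_mul_cancel _ hV, one_mul, mul_smul_comm, mul_one] using h'
  -- The lower-left entry of `v` is `0`, while `φ (N 1 0)` is `R 1 0` times a number that is nonzero
  -- by `hQV`.
  have hγ : R 1 0 = 0 := by
    rw [h10, h00, mul_smul_comm, smul_smul, map_smul, smul_eq_mul] at g10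
    simpa [hz, hw, hQV] using g10
  rw [hγ] at h00 h10 e11
  simp only [mul_zero, zero_smul, add_zero, neg_zero, zero_add] at h00 h10 e11
  have h11 : N 1 1 = w • Ring.inverse D := by
    have h := congrArg (fun x => w • (Ring.inverse D * x)) e11
    simpa only [mul_smul_comm, smul_smul, ← mul_assoc, Ring.inverse_mul_cancel _ hQ, one_mul,
      mul_inv_cancel₀ hw, one_smul, mul_one] using h
  have h01 : N 0 1 = (ζ - z * w * R 0 1) • (Ring.inverse P * Ring.inverse D) := by
    have h := congrArg (fun x => z • (Ring.inverse P * x)) e01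
    simp only [mul_add, mul_smul_comm, mul_zero, smul_zero, smul_add, smul_smul, ← mul_assoc,
      Ring.inverse_mul_cancel _ hP, one_mul, mul_inv_cancel₀ hz, one_smul, h11] at h
    rw [eq_neg_of_add_eq_zero_left h, ← neg_smul]
    congr 1
    field_simp
    ring
  have hbi : biCauchy φ a b (z⁻¹ + R 0 0) (w⁻¹ + R 1 1) =
      z * w * φ (Ring.inverse P * Ring.inverse D) := by
    rw [biCauchy, resolvent_inv_add hz, resolvent_inv_add hw, hα, hδ, smul_mul_smul_comm, map_smul,
      smul_eq_mul]
  refine ⟨hγ, ?_, ?_, ?_, ?_⟩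
  · rw [cauchy, resolvent_inv_add hz, hα, ← h00, g00]
  · rw [cauchy, resolvent_inv_add hw, hδ, ← h11, g11]
  · rw [hbi]
    exact mul_ne_zero (mul_ne_zero hz hw) hPQ
  · rw [hbi]
    rw [h01, map_smul, smul_eq_mul] at g01
    field_simp
    linear_combination -g01

theorem tendsto_upper_zero :
    Tendsto (fun p : ℂ × ℂ × ℂ => (!![p.1, p.2.2; 0, p.2.1] : Matrix (Fin 2) (Fin 2) ℂ))
      (𝓝 0) (𝓝 0) := by
  have hc : Continuous fun p : ℂ × ℂ × ℂ =>
      (!![p.1, p.2.2; 0, p.2.1] : Matrix (Fin 2) (Fin 2) ℂ) := by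
    refine continuous_matrix fun i j => ?_
    fin_cases i <;> fin_cases j <;> simp <;> fun_prop
  have h0 : (!![(0 : ℂ × ℂ × ℂ).1, (0 : ℂ × ℂ × ℂ).2.2; 0, (0 : ℂ × ℂ × ℂ).2.1] :
      Matrix (Fin 2) (Fin 2) ℂ) = 0 := by
    ext i j
    fin_cases i <;> fin_cases j <;> simp
  have hv := hc.tendsto 0
  rwa [h0] at hv

/-- At small upper triangular matrices, the `R`-transform of `diag(a, b)` is described by the
scalar Cauchy transforms. -/
theorem IsMatRTransformOn.eventually_entries (hφ : IsState φ) {a b : A}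
    {Ω : Set (Matrix (Fin 2) (Fin 2) ℂ)} {R : Matrix (Fin 2) (Fin 2) ℂ → Matrix (Fin 2) (Fin 2) ℂ}
    (hR : IsMatRTransformOn φ !![a, 0; 0, b] Ω R) :
    ∀ᶠ p in 𝓝 (0 : ℂ × ℂ × ℂ), p.1 ≠ 0 → p.2.1 ≠ 0 → ∀ M, M = R !![p.1, p.2.2; 0, p.2.1] →
      (p.1⁻¹ + M 0 0 ∈ resolventSet ℂ a ∧ cauchy φ a (p.1⁻¹ + M 0 0) = p.1) ∧
      (p.2.1⁻¹ + M 1 1 ∈ resolventSet ℂ b ∧ cauchy φ b (p.2.1⁻¹ + M 1 1) = p.2.1) ∧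
      biCauchy φ a b (p.1⁻¹ + M 0 0) (p.2.1⁻¹ + M 1 1) ≠ 0 ∧ M 1 0 = 0 ∧
      M 0 1 = p.2.2 * (1 / (p.1 * p.2.1) -
        1 / biCauchy φ a b (p.1⁻¹ + M 0 0) (p.2.1⁻¹ + M 1 1)) := by
  have hv := tendsto_upper_zero
  have hRv := (hR.analytic 0 hR.zero_mem).continuousAt.tendsto.comp hv
  have hent : ∀ i j, Tendsto (fun p : ℂ × ℂ × ℂ => R !![p.1, p.2.2; 0, p.2.1] i j) (𝓝 0)
      (𝓝 (R 0 i j)) := fun i j =>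
    ((continuous_id.matrix_elem i j).tendsto (R 0)).comp hRv
  have hz : Tendsto (fun p : ℂ × ℂ × ℂ => p.1) (𝓝 0) (𝓝 0) := continuous_fst.tendsto 0
  have hw : Tendsto (fun p : ℂ × ℂ × ℂ => p.2.1) (𝓝 0) (𝓝 0) := by
    have : Continuous (fun p : ℂ × ℂ × ℂ => p.2.1) := by fun_prop
    exact this.tendsto 0
  have hζ : Tendsto (fun p : ℂ × ℂ × ℂ => p.2.2) (𝓝 0) (𝓝 0) := by
    have : Continuous (fun p : ℂ × ℂ × ℂ => p.2.2) := by fun_prop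
    exact this.tendsto 0
  have hP := tendsto_smul_sub hz (hent 0 0) a
  have hQ := tendsto_smul_sub hw (hent 1 1) b
  -- The factor `ζ - z w R 0 1` tends to `0`, so it is enough that `R 1 0` stays bounded.
  have hV := hP.add (((hζ.sub ((hz.mul hw).mul (hent 0 1))).mul (hent 1 0)).smul
    (tendsto_inverse_one_add.comp hQ))
  simp only [zero_mul, mul_zero, sub_zero, zero_smul, add_zero] at hV
  filter_upwards [hP.eventually eventually_isUnit_one_add, hQ.eventually eventually_isUnit_one_add,
    hV.eventually eventually_isUnit_one_add, eventually_apply_inverse_mul_ne_zero hφ hP hQ,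
    eventually_apply_inverse_mul_ne_zero hφ hQ hV,
    hv.eventually (hR.isOpen.mem_nhds hR.zero_mem)] with p h1 h2 h3 h4 h5 h6 hp1 hp2 M hM
  subst hM
  obtain ⟨hu, hG⟩ := hR.inverse _ h6 (isUnit_upper hp1 hp2 _)
  obtain ⟨k1, k2, k3, k4, k5⟩ := entries_of_matCauchy_eq hp1 hp2 h1 h2 h3 h4 h5 hu hG
  exact ⟨⟨(mem_resolventSet_inv_add hp1).mpr h1, k2⟩, ⟨(mem_resolventSet_inv_add hp2).mpr h2, k3⟩,
    k4, k1, k5⟩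

end Triangular

end BiFreeProb

end
noncomputable section

namespace BiFreeProb

open Filter

/-! ### Arbitrary upper-right entries, by analytic continuation -/

section Upper

variable {A : Type u} [CStarAlgebra A] {φ : A →ₗ[ℂ] ℂ}

theorem upper_eq_add_smul (z w ζ c : ℂ) :
    (!![z, ζ * c; 0, w] : Matrix (Fin 2) (Fin 2) ℂ) = !![z, 0; 0, w] + ζ • !![0, c; 0, 0] := by
  ext i j
  fin_cases i <;> fin_cases j <;> simp

/-- Analyticity near `0` only controls small `ζ`. For fixed `z, w`, however, `Ω` contains the whole
line in `ζ`, both sides are entire there, and the identity theorem applies. -/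
theorem IsMatRTransformOn.upper (hφ : IsState φ) {a b : A} {Ra Rb : ℂ → ℂ}
    (hRa : IsRTransform φ a Ra) (hRb : IsRTransform φ b Rb)
    {Ω : Set (Matrix (Fin 2) (Fin 2) ℂ)} {R : Matrix (Fin 2) (Fin 2) ℂ → Matrix (Fin 2) (Fin 2) ℂ}
    (hΩ : ContainsUpper Ω) (hR : IsMatRTransformOn φ !![a, 0; 0, b] Ω R) :
    ∃ ε > 0, ∀ z w ζ : ℂ, ‖z‖ < ε → ‖w‖ < ε → z ≠ 0 → w ≠ 0 →
      biCauchy φ a b (z⁻¹ + Ra z) (w⁻¹ + Rb w) ≠ 0 ∧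
      R !![z, ζ; 0, w] = !![Ra z, ζ * (1 / (z * w) -
        1 / biCauchy φ a b (z⁻¹ + Ra z) (w⁻¹ + Rb w)); 0, Rb w] := by
  let S : Set (ℂ × ℂ × ℂ) := {p | p.1 ≠ 0 ∧ p.2.1 ≠ 0}
  have hev := hR.eventually_entries hφ
  have hev' : ∀ᶠ p in 𝓝[S] (0 : ℂ × ℂ × ℂ), _ :=
    (hev.filter_mono nhdsWithin_le_nhds).and eventually_mem_nhdsWithin
  have hz : Tendsto (fun p : ℂ × ℂ × ℂ => p.1) (𝓝[S] 0) (𝓝[≠] 0) :=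
    tendsto_nhdsWithin_iff.mpr ⟨(continuous_fst.tendsto 0).mono_left nhdsWithin_le_nhds,
      eventually_mem_nhdsWithin.mono fun p hp => hp.1⟩
  have hw : Tendsto (fun p : ℂ × ℂ × ℂ => p.2.1) (𝓝[S] 0) (𝓝[≠] 0) :=
    tendsto_nhdsWithin_iff.mpr ⟨((continuous_fst.comp continuous_snd).tendsto 0).mono_left
      nhdsWithin_le_nhds, eventually_mem_nhdsWithin.mono fun p hp => hp.2⟩
  have hv := tendsto_upper_zero
  have hRv := (hR.analytic 0 hR.zero_mem).continuousAt.tendsto.comp hv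
  have hent : ∀ i j, Tendsto (fun p : ℂ × ℂ × ℂ => R !![p.1, p.2.2; 0, p.2.1] i j) (𝓝[S] 0)
      (𝓝 (R 0 i j)) := fun i j =>
    (((continuous_id.matrix_elem i j).tendsto (R 0)).comp hRv).mono_left nhdsWithin_le_nhds
  have ha := hRa.eventuallyEq hφ hz (hent 0 0)
    (hev'.mono fun p hp => (hp.1 hp.2.1 hp.2.2 _ rfl).1)
  have hb := hRb.eventuallyEq hφ hw (hent 1 1)
    (hev'.mono fun p hp => (hp.1 hp.2.1 hp.2.2 _ rfl).2.1)
  have hall : ∀ᶠ p in 𝓝[S] (0 : ℂ × ℂ × ℂ),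
      biCauchy φ a b (p.1⁻¹ + Ra p.1) (p.2.1⁻¹ + Rb p.2.1) ≠ 0 ∧
      R !![p.1, p.2.2; 0, p.2.1] = !![Ra p.1, p.2.2 * (1 / (p.1 * p.2.1) -
        1 / biCauchy φ a b (p.1⁻¹ + Ra p.1) (p.2.1⁻¹ + Rb p.2.1)); 0, Rb p.2.1] := by
    filter_upwards [hev', ha, hb] with p hp ha hb
    obtain ⟨-, -, k1, k2, k3⟩ := hp.1 hp.2.1 hp.2.2 _ rfl
    rw [ha, hb] at k1 k3
    refine ⟨k1, ?_⟩
    ext i j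
    fin_cases i <;> fin_cases j
    · exact ha
    · exact k3
    · exact k2
    · exact hb
  rw [eventually_nhdsWithin_iff, Metric.eventually_nhds_iff] at hall
  obtain ⟨ε, hε, H⟩ := hall
  obtain ⟨δ, hδ, HΩ⟩ := hΩ
  have key : ∀ z w ζ : ℂ, ‖z‖ < ε → ‖w‖ < ε → ‖ζ‖ < ε → z ≠ 0 → w ≠ 0 →
      biCauchy φ a b (z⁻¹ + Ra z) (w⁻¹ + Rb w) ≠ 0 ∧
      R !![z, ζ; 0, w] = !![Ra z, ζ * (1 / (z * w) -
        1 / biCauchy φ a b (z⁻¹ + Ra z) (w⁻¹ + Rb w)); 0, Rb w] := by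
    intro z w ζ h1 h2 h3 h4 h5
    refine @H (z, w, ζ) ?_ ⟨h4, h5⟩
    rw [dist_zero_right]
    simp [Prod.norm_def, h1, h2, h3]
  refine ⟨min ε δ, lt_min hε hδ, fun z w ζ hz hw hz0 hw0 => ?_⟩
  rw [lt_min_iff] at hz hw
  refine ⟨(key z w 0 hz.1 hw.1 (by simpa using hε) hz0 hw0).1, ?_⟩
  set c := 1 / (z * w) - 1 / biCauchy φ a b (z⁻¹ + Ra z) (w⁻¹ + Rb w) with hcdef
  have e1 : AnalyticOnNhd ℂ (fun ζ : ℂ => R !![z, ζ; 0, w]) Set.univ := by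
    intro ζ _
    have h := hR.analytic _ (HΩ z w ζ hz.2 hw.2)
    refine AnalyticAt.fun_comp (f := fun ζ : ℂ => (!![z, ζ; 0, w] : Matrix (Fin 2) (Fin 2) ℂ)) h ?_
    have e : (fun ζ : ℂ => (!![z, ζ; 0, w] : Matrix (Fin 2) (Fin 2) ℂ)) =
        fun ζ => !![z, 0; 0, w] + ζ • !![0, 1; 0, 0] := by
      funext ζ
      rw [← upper_eq_add_smul, mul_one]
    rw [e]
    fun_prop
  have e2 : AnalyticOnNhd ℂ (fun ζ : ℂ => (!![Ra z, ζ * c; 0, Rb w] : Matrix (Fin 2) (Fin 2) ℂ))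
      Set.univ := by
    intro ζ _
    simp only [upper_eq_add_smul]
    fun_prop
  have e3 : (fun ζ : ℂ => R !![z, ζ; 0, w]) =ᶠ[𝓝 0]
      (fun ζ : ℂ => (!![Ra z, ζ * c; 0, Rb w] : Matrix (Fin 2) (Fin 2) ℂ)) := by
    filter_upwards [Metric.ball_mem_nhds (0 : ℂ) hε] with ζ hζ
    exact (key z w ζ hz.1 hw.1 (by simpa using hζ) hz0 hw0).2
  exact congrFun (e1.eq_of_eventuallyEq e2 e3) ζ

end Upper

end BiFreeProb

end
noncomputable section

namespace BiFreeProb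

open Filter
open scoped ContDiff

/-! ### Inversion of two-by-two block matrices -/

section Schur

variable {B : Type*} [Ring B] [Algebra ℂ B]

/-- The inverse of `!![p, ζ q; η q', d]` in terms of `D = d⁻¹` and of the inverse `n` of the Schur
complement. -/
def schurInverse (ζ η : ℂ) (q q' D n : B) : Matrix (Fin 2) (Fin 2) B :=
  !![n, -(ζ • (n * q * D)); -(η • (D * q' * n)), D + (ζ * η) • (D * q' * n * q * D)]

theorem mul_schurInverse {ζ η : ℂ} {p q q' d D n : B} (h1 : d * D = 1)
    (h2 : (p - (ζ * η) • (q * D * q')) * n = 1) :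
    !![p, ζ • q; η • q', d] * schurInverse ζ η q q' D n = 1 := by
  have h3 : p * n = 1 + (ζ * η) • (q * D * q' * n) := by
    rw [← h2, sub_mul, smul_mul_assoc]; abel
  rw [schurInverse, Matrix.mul_fin_two, Matrix.one_fin_two]
  have e : p * n + (ζ • q) * (-(η • (D * q' * n))) = 1 ∧
      p * (-(ζ • (n * q * D))) + (ζ • q) * (D + (ζ * η) • (D * q' * n * q * D)) = 0 ∧
      (η • q') * n + d * (-(η • (D * q' * n))) = 0 ∧
      (η • q') * (-(ζ • (n * q * D))) + d * (D + (ζ * η) • (D * q' * n * q * D)) = 1 := by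
    refine ⟨?_, ?_, ?_, ?_⟩
    · simp only [mul_neg, smul_mul_smul_comm, h3, mul_assoc]; abel
    · simp only [mul_neg, mul_smul_comm, smul_mul_assoc, mul_add, ← mul_assoc, h3, add_mul, one_mul,
        smul_add, smul_smul]
      module
    · simp only [mul_neg, mul_smul_comm, smul_mul_assoc, ← mul_assoc, h1, one_mul, add_neg_cancel]
    · simp only [mul_neg, mul_smul_comm, smul_mul_assoc, mul_add, ← mul_assoc, h1, one_mul,
        smul_smul]
      module
  rw [e.1, e.2.1, e.2.2.1, e.2.2.2]

theorem schurInverse_mul {ζ η : ℂ} {p q q' d D n : B} (h1 : D * d = 1)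
    (h2 : n * (p - (ζ * η) • (q * D * q')) = 1) :
    schurInverse ζ η q q' D n * !![p, ζ • q; η • q', d] = 1 := by
  have h3 : n * p = 1 + (ζ * η) • (n * (q * (D * q'))) := by
    rw [← h2, mul_sub, mul_smul_comm]; simp only [mul_assoc]; abel
  rw [schurInverse, Matrix.mul_fin_two, Matrix.one_fin_two]
  have e : n * p + (-(ζ • (n * q * D))) * (η • q') = 1 ∧
      n * (ζ • q) + (-(ζ • (n * q * D))) * d = 0 ∧
      (-(η • (D * q' * n))) * p + (D + (ζ * η) • (D * q' * n * q * D)) * (η • q') = 0 ∧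
      (-(η • (D * q' * n))) * (ζ • q) + (D + (ζ * η) • (D * q' * n * q * D)) * d = 1 := by
    refine ⟨?_, ?_, ?_, ?_⟩
    · simp only [neg_mul, smul_mul_smul_comm, h3, mul_assoc]; abel
    · simp only [neg_mul, mul_smul_comm, smul_mul_assoc, mul_assoc, h1, mul_one, add_neg_cancel]
    · simp only [neg_mul, mul_smul_comm, smul_mul_assoc, add_mul, mul_assoc, h3, mul_add, mul_one,
        smul_add, smul_smul]
      module
    · simp only [neg_mul, mul_smul_comm, smul_mul_assoc, add_mul, mul_assoc, h1, mul_one]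
      module
  rw [e.1, e.2.1, e.2.2.1, e.2.2.2]

end Schur

/-! ### A form of the R-transform equation that is regular at `v = 0` -/

section MatrixExpectation

variable {A : Type u} [CStarAlgebra A] {φ : A →ₗ[ℂ] ℂ}

theorem map_mul_scalar (N : Matrix (Fin 2) (Fin 2) A) (v : Matrix (Fin 2) (Fin 2) ℂ) :
    (N * v.map (algebraMap ℂ A)).map φ = N.map φ * v := by
  ext i j
  simp [Matrix.mul_apply, ← Algebra.commutes, ← Algebra.smul_def, mul_comm]

theorem map_scalar_mul (N : Matrix (Fin 2) (Fin 2) A) (v : Matrix (Fin 2) (Fin 2) ℂ) :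
    (v.map (algebraMap ℂ A) * N).map φ = v * N.map φ := by
  ext i j
  simp [Matrix.mul_apply, ← Algebra.smul_def]

/-- If `N` is the inverse of `1 + v (R - X)`, and the expectation of `(R - X) N` vanishes, then
`G_X(v⁻¹ + R) = v`. -/
theorem matCauchy_of_inverse (hφ : IsState φ) {v R : Matrix (Fin 2) (Fin 2) ℂ}
    {X N : Matrix (Fin 2) (Fin 2) A} (hv : IsUnit v)
    (h1 : (1 + v.map (algebraMap ℂ A) * matSub R X) * N = 1)
    (h2 : N * (1 + v.map (algebraMap ℂ A) * matSub R X) = 1)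
    (h3 : (matSub R X * N).map φ = 0) :
    IsUnit (matSub (v⁻¹ + R) X) ∧ matCauchy φ X (v⁻¹ + R) = v := by
  have hdet := (Matrix.isUnit_iff_isUnit_det v).mp hv
  have e1 : v.map (algebraMap ℂ A) * (v⁻¹).map (algebraMap ℂ A) = 1 := by
    rw [← Matrix.map_mul, Matrix.mul_nonsing_inv _ hdet]
    simp
  have e2 : (v⁻¹).map (algebraMap ℂ A) * v.map (algebraMap ℂ A) = 1 := by
    rw [← Matrix.map_mul, Matrix.nonsing_inv_mul _ hdet]
    simp
  have hM : matSub (v⁻¹ + R) X =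
      (v⁻¹).map (algebraMap ℂ A) * (1 + v.map (algebraMap ℂ A) * matSub R X) := by
    rw [mul_add, mul_one, ← mul_assoc, e2, one_mul, matSub, matSub, Matrix.map_add _ (map_add _),
      add_sub_assoc]
  let U : (Matrix (Fin 2) (Fin 2) A)ˣ :=
    ⟨matSub (v⁻¹ + R) X, N * v.map (algebraMap ℂ A), by
      rw [hM, mul_assoc, ← mul_assoc _ N, h1, one_mul, e2], by
      rw [hM, mul_assoc, ← mul_assoc (v.map _), e1, one_mul, h2]⟩
  refine ⟨U.isUnit, ?_⟩
  have hinv : Ring.inverse (matSub (v⁻¹ + R) X) = N * v.map (algebraMap ℂ A) :=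
    Ring.inverse_unit U
  -- Since `N = 1 - v (R - X) N`, the expectation of `N` is `1` as soon as that of `(R - X) N`
  -- vanishes.
  have hN : N.map φ = 1 := by
    have h : N = 1 - v.map (algebraMap ℂ A) * (matSub R X * N) := by
      rw [← h1, add_mul, one_mul, mul_assoc, add_sub_cancel_right]
    have h' := congrArg (fun M => M.map φ) h
    simp only [Matrix.map_sub _ (map_sub φ), map_scalar_mul, h3, mul_zero, sub_zero] at h'
    rw [h']
    ext i j
    rw [Matrix.map_apply, Matrix.one_apply, Matrix.one_apply]
    split_ifs <;> simp [hφ.map_one]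
  rw [matCauchy, hinv, map_mul_scalar, hN, one_mul]

end MatrixExpectation

end BiFreeProb

end
noncomputable section

namespace BiFreeProb

open Filter
open scoped ContDiff

/-! ### Solving the equation by the implicit function theorem -/

section Implicit

variable {A : Type u} [CStarAlgebra A] {φ : A →ₗ[ℂ] ℂ}

/-- The entries of the expectation of `(R - diag(a, b)) N` for `R = !![f, ζ g; η h, k]` and
`N = schurInverse ζ η q q' D n`, with `s = ζ η`, up to factors `1`, `ζ`, `η`, `1`. -/
def schurExpectation (φ : A →ₗ[ℂ] ℂ) (a b : A) (s f g h k : ℂ) (q q' D n : A) : ℂ × ℂ × ℂ × ℂ :=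
  (φ ((f • 1 - a) * n - (s * g) • (D * q' * n)),
    φ (g • (D + s • (D * q' * n * q * D)) - (f • 1 - a) * (n * q * D)),
    φ (h • n - (k • 1 - b) * (D * q' * n)),
    φ ((k • 1 - b) * (D + s • (D * q' * n * q * D)) - (s * h) • (n * q * D)))

theorem contDiffAt_schurExpectation (hφ : Continuous φ) (a b : A) {E : Type*}
    [NormedAddCommGroup E] [NormedSpace ℂ E] {u : E} {s f g h k : E → ℂ} {q q' D n : E → A}
    (hs : ContDiffAt ℂ ω s u) (hf : ContDiffAt ℂ ω f u) (hg : ContDiffAt ℂ ω g u)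
    (hh : ContDiffAt ℂ ω h u) (hk : ContDiffAt ℂ ω k u) (hq : ContDiffAt ℂ ω q u)
    (hq' : ContDiffAt ℂ ω q' u) (hD : ContDiffAt ℂ ω D u) (hn : ContDiffAt ℂ ω n u) :
    ContDiffAt ℂ ω (fun x => schurExpectation φ a b (s x) (f x) (g x) (h x) (k x) (q x) (q' x)
      (D x) (n x)) u := by
  let φc : A →L[ℂ] ℂ := ⟨φ, hφ⟩
  have e : ∀ x, φ x = φc x := fun x => rfl
  simp only [schurExpectation, e]
  fun_prop

theorem ContDiffAt.ringInverse {E : Type*} [NormedAddCommGroup E] [NormedSpace ℂ E] {u : E}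
    {F : E → A} (hF : ContDiffAt ℂ ω F u) (hu : IsUnit (F u)) :
    ContDiffAt ℂ ω (fun x => Ring.inverse (F x)) u := by
  obtain ⟨y, hy⟩ := hu
  have h := contDiffAt_ringInverse ℂ (n := ω) y
  rw [hy] at h
  exact h.comp u hF

/-- The blocks of `1 + v (R - diag(a, b))` with `v = !![z, ζ; η, w]`, `R = !![f, ζ g; η h, k]` and
`s = ζ η`: this matrix is `!![1 + pBlock, ζ qBlock; η qBlock', 1 + dBlock]`. -/
def pBlock (a : A) (z s f h : ℂ) : A := z • (f • 1 - a) + (s * h) • 1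

/-- The block `q` of `1 + v (R - diag(a, b))`, see `pBlock`. -/
def qBlock (b : A) (z g k : ℂ) : A := (z * g) • 1 + (k • 1 - b)

/-- The block `q'` of `1 + v (R - diag(a, b))`, see `pBlock`. -/
def qBlock' (a : A) (w f h : ℂ) : A := (f • 1 - a) + (w * h) • 1

/-- The block `d - 1` of `1 + v (R - diag(a, b))`, see `pBlock`. -/
def dBlock (b : A) (w s g k : ℂ) : A := (s * g) • 1 + w • (k • 1 - b)

/-- The Schur complement of the block `1 + dBlock`. -/
def schurBlock (a b : A) (z w s f g h k : ℂ) : A :=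
  1 + pBlock a z s f h -
    s • (qBlock b z g k * Ring.inverse (1 + dBlock b w s g k) * qBlock' a w f h)

/-- `schurExpectation` for the blocks of `1 + v (R - diag(a, b))`. -/
def blockExpectation (φ : A →ₗ[ℂ] ℂ) (a b : A) (z w s f g h k : ℂ) : ℂ × ℂ × ℂ × ℂ :=
  schurExpectation φ a b s f g h k (qBlock b z g k) (qBlock' a w f h)
    (Ring.inverse (1 + dBlock b w s g k)) (Ring.inverse (schurBlock a b z w s f g h k))

/-- At the base point all inverses are `1`, and the system is triangular: `f` and `k` are determined
alone, and they then determine `g` and `h`. -/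
theorem blockExpectation_zero (hφ : IsState φ) (a b : A) (f g h k : ℂ) :
    blockExpectation φ a b 0 0 0 f g h k =
      (f - φ a, g - (f * k - f * φ b - k * φ a) - φ (a * b),
        h - (f * k - f * φ b - k * φ a) - φ (b * a), k - φ b) := by
  simp only [blockExpectation, schurExpectation, schurBlock, pBlock, qBlock, qBlock', dBlock,
    zero_mul, zero_smul, add_zero, sub_zero, zero_add, Ring.inverse_one, mul_one, one_mul,
    map_sub, map_smul, hφ.map_one, smul_eq_mul, mul_sub, sub_mul, smul_mul_assoc, mul_smul_comm]
  ext <;> ring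

theorem exists_blockExpectation_eq_zero (hφ : IsState φ) (a b : A) :
    ∃ δ > 0, ∃ f g h k : ℂ × ℂ × ℂ → ℂ,
      ∀ x, ‖x‖ < δ → AnalyticAt ℂ f x ∧ AnalyticAt ℂ g x ∧ AnalyticAt ℂ h x ∧ AnalyticAt ℂ k x ∧
        IsUnit (1 + dBlock b x.2.1 x.2.2 (g x) (k x)) ∧
        IsUnit (schurBlock a b x.1 x.2.1 x.2.2 (f x) (g x) (h x) (k x)) ∧
        blockExpectation φ a b x.1 x.2.1 x.2.2 (f x) (g x) (h x) (k x) = 0 := by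
  -- Shifting the unknowns `g`, `h` by `m` undoes the triangular part, so that `F (0, y) = y - c`
  -- and the partial derivative in `y` is the identity.
  let m : ℂ × ℂ × ℂ × ℂ → ℂ := fun y => y.1 * y.2.2.2 - y.1 * φ b - y.2.2.2 * φ a
  let G : ℂ × ℂ × ℂ × ℂ → ℂ := fun y => y.2.1 + m y
  let H : ℂ × ℂ × ℂ × ℂ → ℂ := fun y => y.2.2.1 + m y
  let D : (ℂ × ℂ × ℂ) × (ℂ × ℂ × ℂ × ℂ) → A := fun u =>
    1 + dBlock b u.1.2.1 u.1.2.2 (G u.2) u.2.2.2.2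
  let S : (ℂ × ℂ × ℂ) × (ℂ × ℂ × ℂ × ℂ) → A := fun u =>
    schurBlock a b u.1.1 u.1.2.1 u.1.2.2 u.2.1 (G u.2) (H u.2) u.2.2.2.2
  let F : (ℂ × ℂ × ℂ) × (ℂ × ℂ × ℂ × ℂ) → ℂ × ℂ × ℂ × ℂ := fun u =>
    blockExpectation φ a b u.1.1 u.1.2.1 u.1.2.2 u.2.1 (G u.2) (H u.2) u.2.2.2.2
  let c : ℂ × ℂ × ℂ × ℂ := (φ a, φ (a * b), φ (b * a), φ b)
  have hF0 : ∀ y, F (0, y) = y - c := by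
    intro y
    simp only [F, Prod.fst_zero, Prod.snd_zero, blockExpectation_zero hφ, G, H, m, c]
    ext <;> simp
  have hD0 : ∀ y, D (0, y) = 1 := fun y => by simp [D, dBlock]
  have hS0 : ∀ y, S (0, y) = 1 := fun y => by simp [S, schurBlock, pBlock]
  let u₀ : (ℂ × ℂ × ℂ) × (ℂ × ℂ × ℂ × ℂ) := (0, c)
  have hD1 : ContDiffAt ℂ ω D u₀ := by
    simp only [D, dBlock, G, m]
    fun_prop
  have hD2 : ContDiffAt ℂ ω (fun u => Ring.inverse (D u)) u₀ :=
    ContDiffAt.ringInverse hD1 (by rw [hD0]; exact isUnit_one)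
  have hq : ContDiffAt ℂ ω (fun u : (ℂ × ℂ × ℂ) × (ℂ × ℂ × ℂ × ℂ) =>
      qBlock b u.1.1 (G u.2) u.2.2.2.2) u₀ := by
    simp only [qBlock, G, m]
    fun_prop
  have hq' : ContDiffAt ℂ ω (fun u : (ℂ × ℂ × ℂ) × (ℂ × ℂ × ℂ × ℂ) =>
      qBlock' a u.1.2.1 u.2.1 (H u.2)) u₀ := by
    simp only [qBlock', H, m]
    fun_prop
  have hp : ContDiffAt ℂ ω (fun u : (ℂ × ℂ × ℂ) × (ℂ × ℂ × ℂ × ℂ) =>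
      1 + pBlock a u.1.1 u.1.2.2 u.2.1 (H u.2)) u₀ := by
    simp only [pBlock, H, m]
    fun_prop
  have hs : ContDiffAt ℂ ω (fun u : (ℂ × ℂ × ℂ) × (ℂ × ℂ × ℂ × ℂ) => u.1.2.2) u₀ := by fun_prop
  have hS1 : ContDiffAt ℂ ω S u₀ := hp.sub (hs.smul ((hq.mul hD2).mul hq'))
  have hS2 : ContDiffAt ℂ ω (fun u => Ring.inverse (S u)) u₀ :=
    ContDiffAt.ringInverse hS1 (by rw [hS0]; exact isUnit_one)
  have hf : ContDiffAt ℂ ω (fun u : (ℂ × ℂ × ℂ) × (ℂ × ℂ × ℂ × ℂ) => u.2.1) u₀ := by fun_prop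
  have hg : ContDiffAt ℂ ω (fun u : (ℂ × ℂ × ℂ) × (ℂ × ℂ × ℂ × ℂ) => G u.2) u₀ := by
    simp only [G, m]
    fun_prop
  have hh : ContDiffAt ℂ ω (fun u : (ℂ × ℂ × ℂ) × (ℂ × ℂ × ℂ × ℂ) => H u.2) u₀ := by
    simp only [H, m]
    fun_prop
  have hk : ContDiffAt ℂ ω (fun u : (ℂ × ℂ × ℂ) × (ℂ × ℂ × ℂ × ℂ) => u.2.2.2.2) u₀ := by fun_prop
  have hF : ContDiffAt ℂ ω F u₀ :=
    contDiffAt_schurExpectation hφ.continuous a b hs hf hg hh hk hq hq' hD2 hS2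
  have hinv : (fderiv ℂ F u₀ ∘L .inr ℂ (ℂ × ℂ × ℂ) (ℂ × ℂ × ℂ × ℂ)).IsInvertible := by
    have h1 : HasFDerivAt F (fderiv ℂ F u₀) (0, c) :=
      (hF.differentiableAt (by simp)).hasFDerivAt
    have h2 : HasFDerivAt (fun y : ℂ × ℂ × ℂ × ℂ => ((0 : ℂ × ℂ × ℂ), y))
        (.inr ℂ (ℂ × ℂ × ℂ) (ℂ × ℂ × ℂ × ℂ)) c := hasFDerivAt_prodMk_right 0 c
    have h3 := h1.comp c h2
    have h4 : HasFDerivAt (F ∘ fun y : ℂ × ℂ × ℂ × ℂ => ((0 : ℂ × ℂ × ℂ), y))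
        (ContinuousLinearMap.id ℂ (ℂ × ℂ × ℂ × ℂ)) c := by
      have : (F ∘ fun y : ℂ × ℂ × ℂ × ℂ => ((0 : ℂ × ℂ × ℂ), y)) = fun y => y - c :=
        funext hF0
      rw [this]
      exact (hasFDerivAt_id c).sub_const c
    rw [h3.unique h4]
    exact ⟨ContinuousLinearEquiv.refl ℂ _, rfl⟩
  have hne : (ω : WithTop ℕ∞) ≠ 0 := by simp
  let Y := hF.implicitFunction hne hinv
  have hY0 : Y 0 = c := hF.implicitFunction_apply_self hne hinv
  have hYan : AnalyticAt ℂ Y 0 := (hF.contDiffAt_implicitFunction hne hinv).analyticAt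
  have hYev : ∀ᶠ x in 𝓝 (0 : ℂ × ℂ × ℂ), F (x, Y x) = 0 := by
    filter_upwards [hF.eventually_apply_implicitFunction hne hinv] with x hx
    rw [show Y = hF.implicitFunction hne hinv from rfl, hx, hF0, sub_self]
  have hcont : Tendsto (fun x => (x, Y x)) (𝓝 0) (𝓝 u₀) := by
    have h : ContinuousAt (fun x => (x, Y x)) 0 := continuousAt_id.prodMk hYan.continuousAt
    have h' := h.tendsto
    rwa [hY0] at h'
  have hDev : ∀ᶠ x in 𝓝 (0 : ℂ × ℂ × ℂ), IsUnit (D (x, Y x)) := by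
    have h := hD1.continuousAt.tendsto.comp hcont
    rw [hD0] at h
    exact h.eventually (Units.isOpen.mem_nhds isUnit_one)
  have hSev : ∀ᶠ x in 𝓝 (0 : ℂ × ℂ × ℂ), IsUnit (S (x, Y x)) := by
    have h := hS1.continuousAt.tendsto.comp hcont
    rw [hS0] at h
    exact h.eventually (Units.isOpen.mem_nhds isUnit_one)
  have hall := hYan.eventually_analyticAt.and (hYev.and (hDev.and hSev))
  obtain ⟨δ, hδ, hx⟩ := Metric.eventually_nhds_iff.mp hall
  refine ⟨δ, hδ, fun x => (Y x).1, fun x => G (Y x), fun x => H (Y x), fun x => (Y x).2.2.2,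
    fun x hxδ => ?_⟩
  obtain ⟨k1, k2, k3, k4⟩ := hx (y := x) (by simpa using hxδ)
  have hY : ContDiffAt ℂ ω Y x := k1.contDiffAt
  refine ⟨ContDiffAt.analyticAt (by fun_prop), ContDiffAt.analyticAt ?_, ContDiffAt.analyticAt ?_,
    ContDiffAt.analyticAt (by fun_prop), k3, k4, k2⟩
  · simp only [G, m]; fun_prop
  · simp only [H, m]; fun_prop

end Implicit

end BiFreeProb

end
noncomputable section

namespace BiFreeProb

/-! ### Existence of the matrix R-transform -/

section Existence

variable {A : Type u} [CStarAlgebra A] {φ : A →ₗ[ℂ] ℂ}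

theorem one_add_mul_matSub (a b : A) (z w ζ η f g h k : ℂ) :
    (1 + (!![z, ζ; η, w] : Matrix (Fin 2) (Fin 2) ℂ).map (algebraMap ℂ A) *
      matSub !![f, ζ * g; η * h, k] !![a, 0; 0, b]) =
      !![1 + pBlock a z (ζ * η) f h, ζ • qBlock b z g k;
        η • qBlock' a w f h, 1 + dBlock b w (ζ * η) g k] := by
  ext i j
  fin_cases i <;> fin_cases j <;>
    simp [matSub, Matrix.mul_apply, pBlock, qBlock, qBlock', dBlock,
      Algebra.algebraMap_eq_smul_one, smul_smul, smul_sub, smul_add] <;> module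

theorem matSub_mul_schurInverse (a b : A) (ζ η f g h k : ℂ) (q q' D n : A) :
    (matSub !![f, ζ * g; η * h, k] !![a, 0; 0, b] * schurInverse ζ η q q' D n).map φ =
      !![(schurExpectation φ a b (ζ * η) f g h k q q' D n).1,
        ζ * (schurExpectation φ a b (ζ * η) f g h k q q' D n).2.1;
        η * (schurExpectation φ a b (ζ * η) f g h k q q' D n).2.2.1,
        (schurExpectation φ a b (ζ * η) f g h k q q' D n).2.2.2] := by
  ext i j
  fin_cases i <;> fin_cases j <;>
    simp [matSub, Matrix.mul_apply, schurInverse, schurExpectation,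
      Algebra.algebraMap_eq_smul_one, sub_mul] <;> ring

/-- The implicit functions depend on `v` only through `v 0 0`, `v 1 1` and `v 0 1 * v 1 0`. Bounding
these three numbers leaves `v 0 1` free on upper triangular matrices. -/
theorem exists_isMatRTransformOn (hφ : IsState φ) (a b : A) :
    ∃ (Ω : Set (Matrix (Fin 2) (Fin 2) ℂ))
      (R : Matrix (Fin 2) (Fin 2) ℂ → Matrix (Fin 2) (Fin 2) ℂ),
      ContainsUpper Ω ∧ IsMatRTransformOn φ !![a, 0; 0, b] Ω R := by
  obtain ⟨δ, hδ, f, g, h, k, H⟩ := exists_blockExpectation_eq_zero hφ a b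
  let x : Matrix (Fin 2) (Fin 2) ℂ → ℂ × ℂ × ℂ := fun v => (v 0 0, v 1 1, v 0 1 * v 1 0)
  have hent : ∀ i j, AnalyticOnNhd ℂ (fun v : Matrix (Fin 2) (Fin 2) ℂ => v i j) Set.univ :=
    fun i j v _ => ((ContinuousLinearMap.proj (R := ℂ) j).comp
      (ContinuousLinearMap.proj (R := ℂ) (φ := fun _ : Fin 2 => Fin 2 → ℂ) i)).analyticAt v
  have hx : ∀ v, AnalyticAt ℂ x v := fun v =>
    (hent 0 0 v trivial).prod ((hent 1 1 v trivial).prod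
      ((hent 0 1 v trivial).mul (hent 1 0 v trivial)))
  have hmem : ∀ v : Matrix (Fin 2) (Fin 2) ℂ, ‖x v‖ < δ ↔
      ‖v 0 0‖ < δ ∧ ‖v 1 1‖ < δ ∧ ‖v 0 1 * v 1 0‖ < δ := by
    intro v
    rw [Prod.norm_def, Prod.norm_def, max_lt_iff, max_lt_iff]
  refine ⟨{v | ‖x v‖ < δ},
    fun v => !![f (x v), v 0 1 * g (x v); v 1 0 * h (x v), k (x v)],
    ⟨δ, hδ, fun z w ζ hz hw => ?_⟩, ?_, ?_, ?_, ?_, ?_⟩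
  · rw [Set.mem_ofPred_eq, hmem]
    simp [hz, hw, hδ]
  · have hc : Continuous x := continuous_iff_continuousAt.mpr fun v => (hx v).continuousAt
    exact isOpen_lt hc.norm continuous_const
  · have h0 : (0 : Matrix (Fin 2) (Fin 2) ℂ) ∈ {v | ‖x v‖ < δ} := by
      rw [Set.mem_ofPred_eq, hmem]
      simp [hδ]
    -- The set is not convex, but scaling by `t ∈ [0, 1]` shrinks all three quantities.
    have hstar : StarConvex ℝ (0 : Matrix (Fin 2) (Fin 2) ℂ) {v | ‖x v‖ < δ} := by
      rw [starConvex_zero_iff]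
      intro v hv t ht0 ht1
      rw [Set.mem_ofPred_eq, hmem] at hv ⊢
      have habs : |t| ≤ 1 := by rwa [abs_of_nonneg ht0]
      have hle : ∀ c : ℂ, ‖t • c‖ ≤ ‖c‖ := by
        intro c
        rw [norm_smul, Real.norm_eq_abs]
        exact mul_le_of_le_one_left (norm_nonneg c) habs
      simp only [Matrix.smul_apply]
      refine ⟨(hle _).trans_lt hv.1, (hle _).trans_lt hv.2.1, ?_⟩
      rw [norm_mul] at hv ⊢
      exact (mul_le_mul (hle _) (hle _) (norm_nonneg _) (norm_nonneg _)).trans_lt hv.2.2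
    exact (hstar.isPathConnected h0).isConnected.isPreconnected
  · rw [Set.mem_ofPred_eq, hmem]
    simp [hδ]
  · intro v hv
    obtain ⟨hf, hg, hh, hk, -⟩ := H (x v) hv
    have e00 : AnalyticAt ℂ (fun v => f (x v)) v := hf.comp (hx v)
    have e01 : AnalyticAt ℂ (fun v => v 0 1 * g (x v)) v :=
      (hent 0 1 v trivial).mul (hg.comp (hx v))
    have e10 : AnalyticAt ℂ (fun v => v 1 0 * h (x v)) v :=
      (hent 1 0 v trivial).mul (hh.comp (hx v))
    have e11 : AnalyticAt ℂ (fun v => k (x v)) v := hk.comp (hx v)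
    refine AnalyticAt.pi (f := fun i (v : Matrix (Fin 2) (Fin 2) ℂ) =>
      (!![f (x v), v 0 1 * g (x v); v 1 0 * h (x v), k (x v)] : Matrix (Fin 2) (Fin 2) ℂ) i)
      fun i => AnalyticAt.pi fun j => ?_
    fin_cases i <;> fin_cases j
    · exact e00
    · exact e01
    · exact e10
    · exact e11
  · intro v hv hvu
    obtain ⟨-, -, -, -, hD, hS, hE⟩ := H (x v) hv
    have hv2 : v.map (algebraMap ℂ A) = (!![v 0 0, v 0 1; v 1 0, v 1 1]).map (algebraMap ℂ A) :=
      congrArg (fun M => M.map (algebraMap ℂ A)) (Matrix.eta_fin_two v)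
    refine matCauchy_of_inverse hφ hvu (N := schurInverse (v 0 1) (v 1 0)
      (qBlock b (v 0 0) (g (x v)) (k (x v))) (qBlock' a (v 1 1) (f (x v)) (h (x v)))
      (Ring.inverse (1 + dBlock b (v 1 1) (v 0 1 * v 1 0) (g (x v)) (k (x v))))
      (Ring.inverse (schurBlock a b (v 0 0) (v 1 1) (v 0 1 * v 1 0) (f (x v)) (g (x v)) (h (x v))
        (k (x v))))) ?_ ?_ ?_
    · rw [hv2, one_add_mul_matSub]
      exact mul_schurInverse (Ring.mul_inverse_cancel _ hD) (Ring.mul_inverse_cancel _ hS)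
    · rw [hv2, one_add_mul_matSub]
      exact schurInverse_mul (Ring.inverse_mul_cancel _ hD) (Ring.inverse_mul_cancel _ hS)
    · rw [matSub_mul_schurInverse]
      have hE' : schurExpectation φ a b (v 0 1 * v 1 0) (f (x v)) (g (x v)) (h (x v)) (k (x v))
        (qBlock b (v 0 0) (g (x v)) (k (x v))) (qBlock' a (v 1 1) (f (x v)) (h (x v)))
        (Ring.inverse (1 + dBlock b (v 1 1) (v 0 1 * v 1 0) (g (x v)) (k (x v))))
        (Ring.inverse (schurBlock a b (v 0 0) (v 1 1) (v 0 1 * v 1 0) (f (x v)) (g (x v)) (h (x v))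
          (k (x v)))) = 0 := hE
      rw [hE']
      ext i j
      fin_cases i <;> fin_cases j <;> simp

end Existence

end BiFreeProb

end
noncomputable section

namespace BiFreeProb

open Filter

/-! ### Existence of the scalar and bi-free R-transforms -/

section ScalarExistence

variable {A : Type u} [CStarAlgebra A] {φ : A →ₗ[ℂ] ℂ}

theorem AnalyticAt.matrix_elem {E : Type*} [NormedAddCommGroup E] [NormedSpace ℂ E] {x : E}
    {F : E → Matrix (Fin 2) (Fin 2) ℂ} (hF : AnalyticAt ℂ F x) (i j : Fin 2) :
    AnalyticAt ℂ (fun y => F y i j) x :=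
  (((ContinuousLinearMap.proj (R := ℂ) j).comp
    (ContinuousLinearMap.proj (R := ℂ) (φ := fun _ : Fin 2 => Fin 2 → ℂ) i)).analyticAt _).comp hF

theorem analyticAt_upper {E : Type*} [NormedAddCommGroup E] [NormedSpace ℂ E] {x : E}
    {z ζ w : E → ℂ} (hz : AnalyticAt ℂ z x) (hζ : AnalyticAt ℂ ζ x) (hw : AnalyticAt ℂ w x) :
    AnalyticAt ℂ (fun y => (!![z y, ζ y; 0, w y] : Matrix (Fin 2) (Fin 2) ℂ)) x := by
  refine AnalyticAt.pi (f := fun i y => (!![z y, ζ y; 0, w y] : Matrix (Fin 2) (Fin 2) ℂ) i)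
    fun i => AnalyticAt.pi fun j => ?_
  fin_cases i <;> fin_cases j
  · exact hz
  · exact hζ
  · exact analyticAt_const
  · exact hw

/-- Restrict the matrix transform of `diag(a, a)` to scalar matrices and take a diagonal entry. -/
theorem exists_isRTransform (hφ : IsState φ) (a : A) : ∃ R, IsRTransform φ a R := by
  obtain ⟨Ω, R, -, hR⟩ := exists_isMatRTransformOn hφ a a
  have h0 : (!![(0 : ℂ), 0; 0, 0] : Matrix (Fin 2) (Fin 2) ℂ) = 0 := by
    ext i j
    fin_cases i <;> fin_cases j <;> rfl
  refine ⟨fun z => R !![z, 0; 0, z] 0 0, ?_, ?_⟩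
  · refine AnalyticAt.matrix_elem (AnalyticAt.fun_comp (f := fun z : ℂ =>
      (!![z, 0; 0, z] : Matrix (Fin 2) (Fin 2) ℂ)) ?_
      (analyticAt_upper analyticAt_id analyticAt_const analyticAt_id)) 0 0
    rw [h0]
    exact hR.analytic 0 hR.zero_mem
  · have ht : Tendsto (fun z : ℂ => (z, z, (0 : ℂ))) (𝓝[≠] 0) (𝓝 0) := by
      have : Continuous fun z : ℂ => (z, z, (0 : ℂ)) := by fun_prop
      exact (this.tendsto 0).mono_left nhdsWithin_le_nhds
    filter_upwards [ht.eventually (hR.eventually_entries hφ), eventually_mem_nhdsWithin]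
      with z hz hz0
    exact (hz hz0 hz0 _ rfl).1

theorem exists_isBiRTransform (hφ : IsState φ) (a b : A) : ∃ R, IsBiRTransform φ a b R := by
  obtain ⟨Ω, R, ⟨δ, hδ, hΩ⟩, hR⟩ := exists_isMatRTransformOn hφ a b
  obtain ⟨Ra, ha⟩ := exists_isRTransform hφ a
  obtain ⟨Rb, hb⟩ := exists_isRTransform hφ b
  obtain ⟨ε, hε, H⟩ := hR.upper hφ ha hb ⟨δ, hδ, hΩ⟩
  -- The upper-right entry at `ζ = 1` is `1/(zw) - 1/G_{(a,b)}`. It is analytic at `z = w = 0`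
  -- because `!![0, 1; 0, 0]` lies in `Ω`, although it is not small.
  refine ⟨fun z w => z * Ra z + w * Rb w + z * w * R !![z, 1; 0, w] 0 1, ?_, Ra, Rb, ha, hb, ?_⟩
  · have h1 : AnalyticAt ℂ (fun p : ℂ × ℂ => Ra p.1) (0, 0) :=
      AnalyticAt.fun_comp (f := Prod.fst) ha.analyticAt analyticAt_fst
    have h2 : AnalyticAt ℂ (fun p : ℂ × ℂ => Rb p.2) (0, 0) :=
      AnalyticAt.fun_comp (f := Prod.snd) hb.analyticAt analyticAt_snd
    have h3 : AnalyticAt ℂ (fun p : ℂ × ℂ => R !![p.1, 1; 0, p.2] 0 1) (0, 0) := by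
      refine AnalyticAt.matrix_elem (AnalyticAt.fun_comp (f := fun p : ℂ × ℂ =>
        (!![p.1, 1; 0, p.2] : Matrix (Fin 2) (Fin 2) ℂ)) ?_
        (analyticAt_upper analyticAt_fst analyticAt_const analyticAt_snd)) 0 1
      exact hR.analytic _ (hΩ 0 0 1 (by simpa using hδ) (by simpa using hδ))
    exact ((analyticAt_fst.mul h1).add (analyticAt_snd.mul h2)).add
      ((analyticAt_fst.mul analyticAt_snd).mul h3)
  · filter_upwards [Metric.ball_mem_nhds ((0, 0) : ℂ × ℂ) hε] with p hp hz hw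
    have hp' : ‖p‖ < ε := by
      have h := hp
      rwa [Metric.mem_ball, Prod.mk_zero_zero, dist_zero_right] at h
    rw [Prod.norm_def, max_lt_iff] at hp'
    obtain ⟨k1, k2⟩ := H p.1 p.2 1 hp'.1 hp'.2 hz hw
    refine ⟨k1, ?_⟩
    rw [k2]
    simp only [Matrix.of_apply, Matrix.cons_val', Matrix.cons_val_zero, Matrix.cons_val_one,
      Matrix.cons_val_fin_one]
    field_simp
    ring

end ScalarExistence

end BiFreeProb

end
noncomputable section

namespace BiFreeProb

/-! ### Functoriality of free products in the factors -/

section Functoriality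

universe v₁ v₂

variable {E : Fin 2 → PointedSpace.{v₁}} {E' : Fin 2 → PointedSpace.{v₂}}

theorem wordTensor_nil : wordTensor E [] = 1 := rfl

theorem wordTensor_cons (i : Fin 2) (x : (E i).Ker) (l : List (Σ i, (E i).Ker)) :
    wordTensor E (⟨i, x⟩ :: l) = letter E i x * wordTensor E l := by
  simp [wordTensor]

theorem wordTensor_append (l l' : List (Σ i, (E i).Ker)) :
    wordTensor E (l ++ l') = wordTensor E l * wordTensor E l' := by
  simp [wordTensor]

/-- Linear maps agreeing on the elementary tensors agree on the alternating tensors. -/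
theorem eq_of_eq_wordTensor {M : Type*} [AddCommGroup M] [Module ℂ M] {f g : FullFock E →ₗ[ℂ] M}
    (h : ∀ l, f (wordTensor E l) = g (wordTensor E l)) : ∀ t ∈ altTensors E, f t = g t := by
  intro t ht
  induction ht using Submodule.span_induction with
  | zero => simp
  | add s t _ _ hs ht => rw [map_add, map_add, hs, ht]
  | smul c t _ ht => rw [map_smul, map_smul, ht]
  | mem t ht =>
    obtain ⟨l, -, rfl⟩ := ht
    exact h l

/-- A map between vector spaces with distinguished state vectors, respecting these vectors and the
functionals. -/
structure PointedMap (X : PointedSpace.{v₁}) (Y : PointedSpace.{v₂}) where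
  toLin : X.carrier →ₗ[ℂ] Y.carrier
  map_ξ : toLin X.ξ = Y.ξ
  ψ_map : ∀ x, Y.ψ (toLin x) = X.ψ x

/-- The restriction to the kernels of the functionals. -/
def PointedMap.kerMap {X : PointedSpace.{v₁}} {Y : PointedSpace.{v₂}} (f : PointedMap X Y) :
    X.Ker →ₗ[ℂ] Y.Ker :=
  f.toLin.restrict fun x hx => by
    rw [LinearMap.mem_ker] at hx ⊢
    rw [f.ψ_map, hx]

theorem coe_toKer (X : PointedSpace.{v₁}) (x : X.carrier) :
    (X.toKer x : X.carrier) = x - X.ψ x • X.ξ := rfl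

theorem PointedMap.coe_kerMap {X : PointedSpace.{v₁}} {Y : PointedSpace.{v₂}}
    (f : PointedMap X Y) (x : X.Ker) : (f.kerMap x : Y.carrier) = f.toLin x := rfl

theorem PointedMap.kerMap_toKer {X : PointedSpace.{v₁}} {Y : PointedSpace.{v₂}}
    (f : PointedMap X Y) (x : X.carrier) : f.kerMap (X.toKer x) = Y.toKer (f.toLin x) := by
  apply Subtype.ext
  rw [f.coe_kerMap, coe_toKer, coe_toKer, map_sub, map_smul, f.ψ_map, f.map_ξ]

/-- The map of tensor algebras induced by maps of the factors. -/
def fockMap (f : ∀ i, PointedMap (E i) (E' i)) : FullFock E →ₐ[ℂ] FullFock E' :=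
  TensorAlgebra.lift ℂ
    (TensorAlgebra.ι ℂ ∘ₗ LinearMap.pi fun i => (f i).kerMap ∘ₗ LinearMap.proj i)

variable (f : ∀ i, PointedMap (E i) (E' i))

theorem fockMap_letter (i : Fin 2) (x : (E i).Ker) :
    fockMap f (letter E i x) = letter E' i ((f i).kerMap x) := by
  simp only [fockMap, letter, LinearMap.comp_apply, TensorAlgebra.lift_ι_apply]
  congr 1
  funext j
  by_cases h : j = i
  · subst h; simp
  · simp [Pi.single_eq_of_ne h]

theorem fockMap_insert (i : Fin 2) (x : (E i).carrier) (t : FullFock E) :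
    fockMap f (insert E i x t) = insert E' i ((f i).toLin x) (fockMap f t) := by
  simp only [insert_apply, map_add, map_smul, map_mul, fockMap_letter, PointedMap.kerMap_toKer,
    (f i).ψ_map]

theorem vacuum_fockMap (t : FullFock E) : vacuum E' (fockMap f t) = vacuum E t := by
  have h : (TensorAlgebra.algebraMapInv (R := ℂ) (M := ∀ i, (E' i).Ker)).comp (fockMap f) =
      TensorAlgebra.algebraMapInv := by
    apply TensorAlgebra.hom_ext
    ext x
    simp [fockMap, TensorAlgebra.algebraMapInv]
  exact DFunLike.congr_fun h t

theorem fockMap_wordTensor (l : List (Σ i, (E i).Ker)) :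
    fockMap f (wordTensor E l) = wordTensor E' (l.map fun p => ⟨p.1, (f p.1).kerMap p.2⟩) := by
  induction l with
  | nil => simp [wordTensor]
  | cons p l ih =>
    obtain ⟨i, x⟩ := p
    rw [wordTensor_cons, map_mul, ih, fockMap_letter, List.map_cons, wordTensor_cons]

theorem fockMap_reversal : ∀ t ∈ altTensors E,
    fockMap f (reversal E t) = reversal E' (fockMap f t) :=
  eq_of_eq_wordTensor (f := (fockMap f).toLinearMap ∘ₗ reversal E)
    (g := reversal E' ∘ₗ (fockMap f).toLinearMap) fun l => by
      simp [reversal_wordTensor, fockMap_wordTensor]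

variable {f}

theorem fockMap_leftOp {i : Fin 2} {T : Module.End ℂ (E i).carrier}
    {T' : Module.End ℂ (E' i).carrier} (hT : ∀ x, (f i).toLin (T x) = T' ((f i).toLin x)) :
    ∀ t ∈ altTensors E, fockMap f (leftOp E i T t) = leftOp E' i T' (fockMap f t) := by
  refine eq_of_eq_wordTensor (f := (fockMap f).toLinearMap ∘ₗ leftOp E i T)
    (g := leftOp E' i T' ∘ₗ (fockMap f).toLinearMap) fun l => ?_
  simp only [LinearMap.comp_apply, AlgHom.toLinearMap_apply]
  cases l with
  | nil => rw [wordTensor_nil, leftOp_one, fockMap_insert, map_one, leftOp_one, hT, (f i).map_ξ]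
  | cons p l =>
    obtain ⟨j, y⟩ := p
    rw [wordTensor_cons]
    by_cases hij : j = i
    · subst hij
      rw [leftOp_letter_mul, fockMap_insert, map_mul, fockMap_letter, leftOp_letter_mul, hT]
      rfl
    · rw [leftOp_letter_mul_of_ne hij, fockMap_insert, map_mul, fockMap_letter,
        leftOp_letter_mul_of_ne hij, hT, (f i).map_ξ]

theorem fockMap_rightOp {i : Fin 2} {T : Module.End ℂ (E i).carrier}
    {T' : Module.End ℂ (E' i).carrier} (hT : ∀ x, (f i).toLin (T x) = T' ((f i).toLin x))
    (t : FullFock E) (ht : t ∈ altTensors E) :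
    fockMap f (rightOp E i T t) = rightOp E' i T' (fockMap f t) := by
  simp only [rightOp, LinearMap.comp_apply]
  rw [fockMap_reversal f _ (leftOp_mem i T _ (reversal_mem _ ht)),
    fockMap_leftOp hT _ (reversal_mem _ ht), fockMap_reversal f _ ht]

/-- The inclusion of the free product into the tensor algebra. -/
def freeProductVal (E : Fin 2 → PointedSpace.{v₁}) : (freeProduct E).carrier →ₗ[ℂ] FullFock E :=
  (altTensors E).subtype

theorem freeProductVal_mem (x : (freeProduct E).carrier) : freeProductVal E x ∈ altTensors E :=
  SetLike.coe_mem (p := altTensors E) x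

theorem coe_leftRep (i : Fin 2) (T : Module.End ℂ (E i).carrier) (x : (freeProduct E).carrier) :
    freeProductVal E (leftRep E i T x) = leftOp E i T (freeProductVal E x) := rfl

theorem coe_rightRep (i : Fin 2) (T : Module.End ℂ (E i).carrier) (x : (freeProduct E).carrier) :
    freeProductVal E (rightRep E i T x) = rightOp E i T (freeProductVal E x) := rfl

/-- The mixed moments on the free product of the operators on the factors. -/
def mixedMoment (E : Fin 2 → PointedSpace.{v₁}) (S T : ∀ i, Module.End ℂ (E i).carrier)
    (m : List (Fin 2 ⊕ Fin 2)) : ℂ :=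
  (freeProduct E).vectorState
    (m.map (Sum.elim (fun i => leftRep E i (S i)) (fun i => rightRep E i (T i)))).prod

/-- The mixed moments are functorial. -/
theorem mixedMoment_eq_of_map {S T : ∀ i, Module.End ℂ (E i).carrier}
    {S' T' : ∀ i, Module.End ℂ (E' i).carrier}
    (hS : ∀ i x, (f i).toLin (S i x) = S' i ((f i).toLin x))
    (hT : ∀ i x, (f i).toLin (T i x) = T' i ((f i).toLin x)) (m : List (Fin 2 ⊕ Fin 2)) :
    mixedMoment E S T m = mixedMoment E' S' T' m := by
  have key : fockMap f (freeProductVal E ((m.map (Sum.elim (fun i => leftRep E i (S i))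
      (fun i => rightRep E i (T i)))).prod (freeProduct E).ξ)) =
      freeProductVal E' ((m.map (Sum.elim (fun i => leftRep E' i (S' i))
      (fun i => rightRep E' i (T' i)))).prod (freeProduct E').ξ) := by
    induction m with
    | nil => exact map_one (fockMap f)
    | cons p m ih =>
      simp only [List.map_cons, List.prod_cons, Module.End.mul_apply]
      cases p with
      | inl i =>
        rw [Sum.elim_inl, Sum.elim_inl, coe_leftRep, coe_leftRep, ← ih]
        exact fockMap_leftOp (hS i) _ (freeProductVal_mem _)
      | inr i =>
        rw [Sum.elim_inr, Sum.elim_inr, coe_rightRep, coe_rightRep, ← ih]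
        exact fockMap_rightOp (hT i) _ (freeProductVal_mem _)
  have h := congrArg (vacuum E') key
  rw [vacuum_fockMap] at h
  exact h

theorem add_toKer (X : PointedSpace.{v₁}) (x : X.carrier) : X.ψ x • X.ξ + X.toKer x = x := by
  rw [coe_toKer, add_sub_cancel]

/-- The map `x ↦ insert E i x 1` embeds `X_i` in the free product; there the left and right actions
of `T` both reduce to `T` itself. -/
theorem leftOp_insert_one (i : Fin 2) (T : Module.End ℂ (E i).carrier) (x : (E i).carrier) :
    leftOp E i T (insert E i x 1) = insert E i (T x) 1 := by
  conv_rhs => rw [← add_toKer (E i) x]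
  rw [insert_apply, map_add, map_smul, leftOp_one, leftOp_letter_mul, map_add, map_smul, map_add,
    map_smul, LinearMap.add_apply, LinearMap.smul_apply]

theorem reversal_insert_one (i : Fin 2) (x : (E i).carrier) :
    reversal E (insert E i x 1) = insert E i x 1 := by
  rw [insert_apply, map_add, map_smul, reversal_mul, reversal_one, reversal_letter, one_mul,
    mul_one]

theorem rightOp_insert_one (i : Fin 2) (T : Module.End ℂ (E i).carrier) (x : (E i).carrier) :
    rightOp E i T (insert E i x 1) = insert E i (T x) 1 := by
  rw [rightOp, LinearMap.comp_apply, LinearMap.comp_apply, reversal_insert_one, leftOp_insert_one,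
    reversal_insert_one]

theorem vacuum_letter_mul (i : Fin 2) (x : (E i).Ker) (t : FullFock E) :
    vacuum E (letter E i x * t) = 0 := by
  simp [vacuum, letter, TensorAlgebra.algebraMapInv]

theorem vacuum_one : vacuum E 1 = 1 := by simp [vacuum]

/-- The moments of the operators of a single factor. -/
theorem mixedMoment_single (S T : ∀ i, Module.End ℂ (E i).carrier) (i : Fin 2) (l : List Bool) :
    mixedMoment E S T (l.map fun c => cond c (Sum.inl i) (Sum.inr i)) =
      (E i).ψ ((l.map fun c => cond c (S i) (T i)).prod (E i).ξ) := by
  have key : freeProductVal E (((l.map fun c => cond c (Sum.inl i) (Sum.inr i)).map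
      (Sum.elim (fun i => leftRep E i (S i))
      (fun i => rightRep E i (T i)))).prod (freeProduct E).ξ) =
      insert E i ((l.map fun c => cond c (S i) (T i)).prod (E i).ξ) 1 := by
    induction l with
    | nil =>
      have : (E i).toKer (E i).ξ = 0 := by
        apply Subtype.ext
        rw [coe_toKer, (E i).ψ_ξ, one_smul, sub_self, ZeroMemClass.coe_zero]
      simp only [List.map_nil, List.prod_nil, Module.End.one_apply, insert_apply, (E i).ψ_ξ,
        one_smul, this, map_zero, zero_mul, add_zero]
      rfl
    | cons c l ih =>
      simp only [List.map_cons, List.prod_cons, Module.End.mul_apply]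
      cases c with
      | true => rw [cond_true, cond_true, Sum.elim_inl, coe_leftRep, ih, leftOp_insert_one]
      | false => rw [cond_false, cond_false, Sum.elim_inr, coe_rightRep, ih, rightOp_insert_one]
  have h := congrArg (vacuum E) key
  rw [insert_apply, map_add, map_smul, vacuum_letter_mul, vacuum_one, smul_eq_mul, mul_one,
    add_zero] at h
  exact h

end Functoriality

/-! ### Realisation of bi-free pairs on two copies of the algebra -/

section Model

variable {A : Type u} [CStarAlgebra A] {φ : A →ₗ[ℂ] ℂ}

/-- The pointed space `(A, 1, φ)` given by a state. -/
abbrev IsState.pointedSpace (hφ : IsState φ) : PointedSpace.{u} where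
  carrier := A
  ξ := 1
  ψ := φ
  ψ_ξ := hφ.map_one

/-- The pointed space of noncommutative polynomials in two variables with the functional given by
moments `μ`. -/
def polynomialSpace (μ : List Bool → ℂ) (hμ : μ [] = 1) : PointedSpace.{0} where
  carrier := List Bool →₀ ℂ
  ξ := Finsupp.single [] 1
  ψ := Finsupp.linearCombination ℂ μ
  ψ_ξ := by simp [hμ]

/-- Multiplication by a variable. -/
def polynomialShift (μ : List Bool → ℂ) (hμ : μ [] = 1) (c : Bool) :
    Module.End ℂ (polynomialSpace μ hμ).carrier :=
  Finsupp.lmapDomain ℂ ℂ (List.cons c)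

/-- The evaluation of noncommutative polynomials at two operators with the right moments. -/
def polynomialEval {μ : List Bool → ℂ} (hμ : μ [] = 1) (X : PointedSpace.{v})
    (S T : Module.End ℂ X.carrier)
    (h : ∀ l : List Bool, X.ψ ((l.map fun c => cond c S T).prod X.ξ) = μ l) :
    PointedMap (polynomialSpace μ hμ) X where
  toLin := Finsupp.linearCombination ℂ fun l : List Bool => (l.map fun c => cond c S T).prod X.ξ
  map_ξ := (Finsupp.linearCombination_single _ _ _).trans (one_smul ℂ _)
  ψ_map := by
    intro x
    change (X.ψ ∘ₗ Finsupp.linearCombination ℂ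
      fun l : List Bool => (l.map fun c => cond c S T).prod X.ξ) x = Finsupp.linearCombination ℂ μ x
    congr 1
    ext l
    simp [h]

theorem polynomialEval_shift {μ : List Bool → ℂ} (hμ : μ [] = 1) (X : PointedSpace.{v})
    (S T : Module.End ℂ X.carrier)
    (h : ∀ l : List Bool, X.ψ ((l.map fun c => cond c S T).prod X.ξ) = μ l) (c : Bool)
    (x : (polynomialSpace μ hμ).carrier) :
    (polynomialEval hμ X S T h).toLin (polynomialShift μ hμ c x) =
      (cond c S T) ((polynomialEval hμ X S T h).toLin x) := by
  change ((Finsupp.linearCombination ℂ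
      fun l : List Bool => (l.map fun c => cond c S T).prod X.ξ) ∘ₗ
        Finsupp.lmapDomain ℂ ℂ (List.cons c)) x =
    ((cond c S T) ∘ₗ Finsupp.linearCombination ℂ
      fun l : List Bool => (l.map fun c => cond c S T).prod X.ξ) x
  congr 1
  ext l
  simp

/-- Left multiplication by `x` on the pointed space of a state. -/
def IsState.leftMul (hφ : IsState φ) (x : A) : Module.End ℂ hφ.pointedSpace.carrier :=
  LinearMap.mulLeft ℂ x

theorem IsState.prod_leftMul (hφ : IsState φ) (a b : A) (l : List Bool) :
    (l.map fun c => cond c (hφ.leftMul a) (hφ.leftMul b)).prod hφ.pointedSpace.ξ =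
      ((l.map fun c => cond c a b).prod : A) := by
  induction l with
  | nil => rfl
  | cons c l ih =>
    rw [List.map_cons, List.prod_cons, Module.End.mul_apply, ih, List.map_cons, List.prod_cons]
    cases c <;> rfl

/-- For bi-free pairs, the joint distribution is that of the left and right representations of the
multiplication operators of the algebra itself. -/
theorem BiFree.moment_eq (hφ : IsState φ) {a b : Fin 2 → A} (h : BiFree.{u, v} φ a b)
    (m : List (Fin 2 ⊕ Fin 2)) :
    φ (m.map (Sum.elim a b)).prod = mixedMoment (fun _ => hφ.pointedSpace)
      (fun i => hφ.leftMul (a i)) (fun i => hφ.leftMul (b i)) m := by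
  obtain ⟨E, S, T, hm⟩ := h
  let μ : Fin 2 → List Bool → ℂ := fun i l => φ (l.map fun c => cond c (a i) (b i)).prod
  have hμ : ∀ i, μ i [] = 1 := fun i => hφ.map_one
  -- Bi-freeness contains the moments of each single pair, so `(S i, T i)` has the distribution of
  -- `(a i, b i)`.
  have h1 : ∀ i (l : List Bool),
      (E i).ψ ((l.map fun c => cond c (S i) (T i)).prod (E i).ξ) = μ i l := by
    intro i l
    rw [← mixedMoment_single, mixedMoment, ← hm, List.map_map]
    simp only [μ]
    congr 3
    funext c
    cases c <;> rfl
  have h2 : ∀ i (l : List Bool), hφ.pointedSpace.ψ ((l.map fun c =>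
      cond c (hφ.leftMul (a i)) (hφ.leftMul (b i))).prod hφ.pointedSpace.ξ) = μ i l := by
    intro i l
    rw [hφ.prod_leftMul]
  -- There need be no map between `E i` and `A`; the polynomial space maps to both and links their
  -- mixed moments.
  have h3 := mixedMoment_eq_of_map (f := fun i => polynomialEval (hμ i) (E i) (S i) (T i) (h1 i))
    (S := fun i => polynomialShift (μ i) (hμ i) true)
    (T := fun i => polynomialShift (μ i) (hμ i) false) (S' := S) (T' := T)
    (fun i x => polynomialEval_shift (hμ i) (E i) (S i) (T i) (h1 i) true x)
    (fun i x => polynomialEval_shift (hμ i) (E i) (S i) (T i) (h1 i) false x) m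
  have h4 := mixedMoment_eq_of_map
    (f := fun i =>
      polynomialEval (hμ i) hφ.pointedSpace (hφ.leftMul (a i)) (hφ.leftMul (b i)) (h2 i))
    (S := fun i => polynomialShift (μ i) (hμ i) true)
    (T := fun i => polynomialShift (μ i) (hμ i) false) (S' := fun i => hφ.leftMul (a i))
    (T' := fun i => hφ.leftMul (b i))
    (fun i x => polynomialEval_shift (hμ i) _ _ _ (h2 i) true x)
    (fun i x => polynomialEval_shift (hμ i) _ _ _ (h2 i) false x) m
  rw [hm, ← h4, h3]
  rfl

end Model

end BiFreeProb

end
noncomputable section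

namespace BiFreeProb

/-! ### Growth estimates for functionals on words -/

section WordBound

variable {A : Type u} [CStarAlgebra A] {φ : A →ₗ[ℂ] ℂ}

/-- Two copies of the pointed space of a state. -/
abbrev IsState.pair (hφ : IsState φ) : Fin 2 → PointedSpace.{u} := fun _ => hφ.pointedSpace

/-- The norm of a letter. -/
def IsState.letterNorm (hφ : IsState φ) (p : Σ i, (hφ.pair i).Ker) : ℝ := ‖(p.2.1 : A)‖

theorem IsState.letterNorm_nonneg (hφ : IsState φ) (p : Σ i, (hφ.pair i).Ker) :
    0 ≤ hφ.letterNorm p := norm_nonneg _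

/-- The functional `f` is bounded on elementary tensors, where letters are scaled by `C`. -/
def WordBound (hφ : IsState φ) (C C₀ : ℝ) (f : FullFock hφ.pair →ₗ[ℂ] ℂ) : Prop :=
  ∀ l, ‖f (wordTensor hφ.pair l)‖ ≤ C₀ * (l.map fun p => C * hφ.letterNorm p).prod

/-- One constant serves both for `φ` and for the centering `x ↦ x - φ(x) 1`. -/
theorem IsState.exists_bound (hφ : IsState φ) :
    ∃ B : ℝ, 1 ≤ B ∧ (∀ x, ‖φ x‖ ≤ B * ‖x‖) ∧ ∀ x, ‖x - φ x • 1‖ ≤ B * ‖x‖ := by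
  let φc : A →L[ℂ] ℂ := ⟨φ, hφ.continuous⟩
  have h1 : ∀ x, ‖φ x‖ ≤ ‖φc‖ * ‖x‖ := φc.le_opNorm
  have h2 : 0 ≤ ‖φc‖ * ‖(1 : A)‖ := by positivity
  refine ⟨1 + ‖φc‖ + ‖φc‖ * ‖(1 : A)‖, by linarith [norm_nonneg φc], fun x => ?_, fun x => ?_⟩
  · refine (h1 x).trans (mul_le_mul_of_nonneg_right (by linarith) (norm_nonneg x))
  · calc ‖x - φ x • 1‖ ≤ ‖x‖ + ‖φ x‖ * ‖(1 : A)‖ := by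
          rw [← norm_smul]; exact norm_sub_le _ _
      _ ≤ ‖x‖ + ‖φc‖ * ‖x‖ * ‖(1 : A)‖ := by gcongr; exact h1 x
      _ ≤ _ := by
          nlinarith [norm_nonneg x, norm_nonneg φc, mul_nonneg (norm_nonneg φc) (norm_nonneg x)]

theorem WordBound.nonneg {hφ : IsState φ} {C C₀ : ℝ} {f : FullFock hφ.pair →ₗ[ℂ] ℂ}
    (hf : WordBound hφ C C₀ f) : 0 ≤ C₀ := by
  have h := (norm_nonneg _).trans (hf [])
  simpa using h

theorem WordBound.add {hφ : IsState φ} {C C₀ C₁ : ℝ} {f g : FullFock hφ.pair →ₗ[ℂ] ℂ}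
    (hf : WordBound hφ C C₀ f) (hg : WordBound hφ C C₁ g) : WordBound hφ C (C₀ + C₁) (f + g) := by
  intro l
  rw [LinearMap.add_apply, add_mul]
  exact norm_add_le_of_le (hf l) (hg l)

theorem WordBound.comp_reversal {hφ : IsState φ} {C C₀ : ℝ} {f : FullFock hφ.pair →ₗ[ℂ] ℂ}
    (hf : WordBound hφ C C₀ f) : WordBound hφ C C₀ (f ∘ₗ reversal hφ.pair) := by
  intro l
  rw [LinearMap.comp_apply, reversal_wordTensor]
  refine (hf l.reverse).trans_eq ?_
  rw [List.map_reverse, (List.reverse_perm _).prod_eq]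

theorem insert_wordTensor {E : Fin 2 → PointedSpace.{v}} (i : Fin 2) (x : (E i).carrier)
    (l : List (Σ i, (E i).Ker)) :
    insert E i x (wordTensor E l) =
      (E i).ψ x • wordTensor E l + wordTensor E (⟨i, (E i).toKer x⟩ :: l) := by
  rw [insert_apply, wordTensor_cons]

/-- The scalar term of `insert` costs `B ‖x‖` and the new letter costs `C B ‖x‖`. -/
theorem WordBound.norm_insert_le {hφ : IsState φ} {B : ℝ} (hB1 : ∀ x, ‖φ x‖ ≤ B * ‖x‖)
    (hB2 : ∀ x, ‖x - φ x • 1‖ ≤ B * ‖x‖) {C C₀ : ℝ} (hC : 1 ≤ C)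
    {f : FullFock hφ.pair →ₗ[ℂ] ℂ} (hf : WordBound hφ C C₀ f) (i : Fin 2) (x : A)
    (l : List (Σ i, (hφ.pair i).Ker)) :
    ‖f (insert hφ.pair i x (wordTensor hφ.pair l))‖ ≤
      C₀ * (B * (1 + C) * ‖x‖) * (l.map fun p => C * hφ.letterNorm p).prod := by
  have hP : 0 ≤ (l.map fun p => C * hφ.letterNorm p).prod :=
    List.prod_nonneg fun y hy => by
      obtain ⟨p, -, rfl⟩ := List.mem_map.mp hy
      exact mul_nonneg (by linarith) (hφ.letterNorm_nonneg p)
  set P := (l.map fun p => C * hφ.letterNorm p).prod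
  have h1 : ‖(φ x) • f (wordTensor hφ.pair l)‖ ≤ (B * ‖x‖) * (C₀ * P) := by
    rw [norm_smul]
    exact mul_le_mul (hB1 x) (hf l) (norm_nonneg _) ((norm_nonneg _).trans (hB1 x))
  have h2 : ‖f (wordTensor hφ.pair (⟨i, (hφ.pair i).toKer x⟩ :: l))‖ ≤
      C₀ * ((C * (B * ‖x‖)) * P) := by
    refine (hf _).trans (mul_le_mul_of_nonneg_left ?_ hf.nonneg)
    rw [List.map_cons, List.prod_cons]
    exact mul_le_mul_of_nonneg_right (mul_le_mul_of_nonneg_left (hB2 x) (by linarith)) hP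
  rw [insert_wordTensor, map_add, map_smul]
  refine (norm_add_le_of_le h1 h2).trans_eq ?_
  ring

/-- The letter weight `C` is unchanged and only the constant grows, so powers grow geometrically.
This replaces a norm on the tensor algebra. The condition `1 ≤ C` pays for a first letter that is
absorbed into `φ`. -/
theorem WordBound.comp_leftOp {hφ : IsState φ} {B : ℝ} (hB0 : 1 ≤ B)
    (hB1 : ∀ x, ‖φ x‖ ≤ B * ‖x‖) (hB2 : ∀ x, ‖x - φ x • 1‖ ≤ B * ‖x‖) {C C₀ : ℝ} (hC : 1 ≤ C)
    {f : FullFock hφ.pair →ₗ[ℂ] ℂ} (hf : WordBound hφ C C₀ f) (i : Fin 2) (x : A) :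
    WordBound hφ C (C₀ * (B * (1 + C) * ‖x‖)) (f ∘ₗ leftOp hφ.pair i (hφ.leftMul x)) := by
  have hx1 : hφ.leftMul x hφ.pointedSpace.ξ = x := mul_one x
  intro l
  rw [LinearMap.comp_apply]
  cases l with
  | nil =>
    rw [wordTensor_nil, leftOp_one, hx1, ← wordTensor_nil]
    exact hf.norm_insert_le hB1 hB2 hC i x []
  | cons p l =>
    obtain ⟨j, y⟩ := p
    by_cases hij : j = i
    · subst hij
      rw [wordTensor_cons, leftOp_letter_mul]
      refine (hf.norm_insert_le hB1 hB2 hC j (x * (y.1 : A)) l).trans ?_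
      rw [List.map_cons, List.prod_cons]
      have hP : 0 ≤ (l.map fun p => C * hφ.letterNorm p).prod :=
        List.prod_nonneg fun y hy => by
          obtain ⟨p, -, rfl⟩ := List.mem_map.mp hy
          exact mul_nonneg (by linarith) (hφ.letterNorm_nonneg p)
      set P := (l.map fun p => C * hφ.letterNorm p).prod
      rw [mul_assoc C₀, mul_assoc C₀, ← mul_assoc (B * (1 + C) * ‖x‖) _ P]
      refine mul_le_mul_of_nonneg_left (mul_le_mul_of_nonneg_right ?_ hP) hf.nonneg
      rw [mul_assoc (B * (1 + C))]
      refine mul_le_mul_of_nonneg_left ?_ (mul_nonneg (by linarith) (by linarith))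
      have h1 : ‖x * (y.1 : A)‖ ≤ ‖x‖ * ‖(y.1 : A)‖ := norm_mul_le _ _
      have h2 : ‖x‖ * ‖(y.1 : A)‖ ≤ ‖x‖ * (C * ‖(y.1 : A)‖) :=
        mul_le_mul_of_nonneg_left (le_mul_of_one_le_left (norm_nonneg _) hC) (norm_nonneg _)
      exact h1.trans h2
    · rw [wordTensor_cons, leftOp_letter_mul_of_ne hij, hx1, ← wordTensor_cons]
      exact hf.norm_insert_le hB1 hB2 hC i x _

theorem WordBound.comp_rightOp {hφ : IsState φ} {B : ℝ} (hB0 : 1 ≤ B)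
    (hB1 : ∀ x, ‖φ x‖ ≤ B * ‖x‖) (hB2 : ∀ x, ‖x - φ x • 1‖ ≤ B * ‖x‖) {C C₀ : ℝ} (hC : 1 ≤ C)
    {f : FullFock hφ.pair →ₗ[ℂ] ℂ} (hf : WordBound hφ C C₀ f) (i : Fin 2) (x : A) :
    WordBound hφ C (C₀ * (B * (1 + C) * ‖x‖)) (f ∘ₗ rightOp hφ.pair i (hφ.leftMul x)) :=
  (hf.comp_reversal.comp_leftOp hB0 hB1 hB2 hC i x).comp_reversal

/-- The sum of the left representations of two elements. -/
def IsState.leftSum (hφ : IsState φ) (a : Fin 2 → A) : Module.End ℂ (FullFock hφ.pair) :=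
  leftOp hφ.pair 0 (hφ.leftMul (a 0)) + leftOp hφ.pair 1 (hφ.leftMul (a 1))

/-- The sum of the right representations of two elements. -/
def IsState.rightSum (hφ : IsState φ) (b : Fin 2 → A) : Module.End ℂ (FullFock hφ.pair) :=
  rightOp hφ.pair 0 (hφ.leftMul (b 0)) + rightOp hφ.pair 1 (hφ.leftMul (b 1))

theorem WordBound.comp_leftSum_pow {hφ : IsState φ} {B : ℝ} (hB0 : 1 ≤ B)
    (hB1 : ∀ x, ‖φ x‖ ≤ B * ‖x‖) (hB2 : ∀ x, ‖x - φ x • 1‖ ≤ B * ‖x‖) {C C₀ : ℝ} (hC : 1 ≤ C)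
    {f : FullFock hφ.pair →ₗ[ℂ] ℂ} (hf : WordBound hφ C C₀ f) (a : Fin 2 → A) (n : ℕ) :
    WordBound hφ C (C₀ * (B * (1 + C) * (‖a 0‖ + ‖a 1‖)) ^ n) (f ∘ₗ (hφ.leftSum a) ^ n) := by
  induction n with
  | zero => simpa [Module.End.one_eq_id] using hf
  | succ n ih =>
    have h := (ih.comp_leftOp hB0 hB1 hB2 hC 0 (a 0)).add (ih.comp_leftOp hB0 hB1 hB2 hC 1 (a 1))
    rw [← LinearMap.comp_add, ← mul_add, ← mul_add, mul_assoc C₀, ← pow_succ] at h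
    exact h

theorem WordBound.comp_rightSum_pow {hφ : IsState φ} {B : ℝ} (hB0 : 1 ≤ B)
    (hB1 : ∀ x, ‖φ x‖ ≤ B * ‖x‖) (hB2 : ∀ x, ‖x - φ x • 1‖ ≤ B * ‖x‖) {C C₀ : ℝ} (hC : 1 ≤ C)
    {f : FullFock hφ.pair →ₗ[ℂ] ℂ} (hf : WordBound hφ C C₀ f) (b : Fin 2 → A) (n : ℕ) :
    WordBound hφ C (C₀ * (B * (1 + C) * (‖b 0‖ + ‖b 1‖)) ^ n) (f ∘ₗ (hφ.rightSum b) ^ n) := by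
  induction n with
  | zero => simpa [Module.End.one_eq_id] using hf
  | succ n ih =>
    have h := (ih.comp_rightOp hB0 hB1 hB2 hC 0 (b 0)).add (ih.comp_rightOp hB0 hB1 hB2 hC 1 (b 1))
    rw [← LinearMap.comp_add, ← mul_add, ← mul_add, mul_assoc C₀, ← pow_succ] at h
    exact h

theorem WordBound.vacuum (hφ : IsState φ) {C : ℝ} (hC : 0 ≤ C) :
    WordBound hφ C 1 (vacuum hφ.pair) := by
  intro l
  cases l with
  | nil => simp [wordTensor_nil, vacuum_one]
  | cons p l =>
    rw [wordTensor_cons, vacuum_letter_mul, norm_zero, one_mul]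
    exact List.prod_nonneg fun y hy => by
      obtain ⟨p, -, rfl⟩ := List.mem_map.mp hy
      exact mul_nonneg hC (hφ.letterNorm_nonneg p)

end WordBound

/-! ### Moments of the sums -/

section SumMoments

/-- Functionals agreeing on the products of generators agree on products of sums of generators. -/
theorem apply_prod_sum_eq {ι R R' : Type*} [Ring R] [Algebra ℂ R] [Ring R'] [Algebra ℂ R']
    {L : R →ₗ[ℂ] ℂ} {L' : R' →ₗ[ℂ] ℂ} {g : ι → R} {g' : ι → R'}
    (h : ∀ m : List ι, L (m.map g).prod = L' (m.map g').prod) (k : List (Finset ι))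
    (m : List ι) :
    L ((k.map fun s => ∑ i ∈ s, g i).prod * (m.map g).prod) =
      L' ((k.map fun s => ∑ i ∈ s, g' i).prod * (m.map g').prod) := by
  -- Peeling off the last sum lets each of its summands join the word `m`.
  induction k using List.reverseRecOn generalizing m with
  | nil => simpa using h m
  | append_singleton k s ih =>
    simp only [List.map_append, List.map_cons, List.map_nil, List.prod_append, List.prod_cons,
      List.prod_nil, mul_one, mul_assoc, Finset.sum_mul, Finset.mul_sum, map_sum]
    exact Finset.sum_congr rfl fun i _ => by simpa using ih (i :: m)

variable {A : Type u} [CStarAlgebra A] {φ : A →ₗ[ℂ] ℂ}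

theorem BiFree.moment_sum_eq (hφ : IsState φ) {a b : Fin 2 → A} (h : BiFree.{u, v} φ a b)
    (m n : ℕ) :
    φ ((a 0 + a 1) ^ m * (b 0 + b 1) ^ n) =
      vacuum hφ.pair ((hφ.leftSum a ^ m) ((hφ.rightSum b ^ n) 1)) := by
  have h1 := apply_prod_sum_eq (L := φ) (L' := (freeProduct hφ.pair).ψ ∘ₗ
      LinearMap.applyₗ (freeProduct hφ.pair).ξ) (g := Sum.elim a b)
      (g' := Sum.elim (fun i => leftRep hφ.pair i (hφ.leftMul (a i)))
        (fun i => rightRep hφ.pair i (hφ.leftMul (b i)))) (fun l => h.moment_eq hφ l)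
      (List.replicate m {Sum.inl 0, Sum.inl 1} ++ List.replicate n {Sum.inr 0, Sum.inr 1}) []
  simp only [List.map_append, List.map_replicate, List.prod_append, List.prod_replicate,
    List.map_nil, List.prod_nil, mul_one, Finset.sum_pair (show (Sum.inl 0 : Fin 2 ⊕ Fin 2) ≠
      Sum.inl 1 by simp), Finset.sum_pair (show (Sum.inr 0 : Fin 2 ⊕ Fin 2) ≠
      Sum.inr 1 by simp), Sum.elim_inl, Sum.elim_inr] at h1
  rw [h1]
  have hl : ∀ (m : ℕ) x, freeProductVal hφ.pair (((leftRep hφ.pair 0 (hφ.leftMul (a 0)) +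
      leftRep hφ.pair 1 (hφ.leftMul (a 1))) ^ m) x) =
      (hφ.leftSum a ^ m) (freeProductVal hφ.pair x) := by
    intro m
    induction m with
    | zero => intro x; rfl
    | succ m ih =>
      intro x
      rw [pow_succ, pow_succ, Module.End.mul_apply, Module.End.mul_apply, ih]
      rfl
  have hr : ∀ (m : ℕ) x, freeProductVal hφ.pair (((rightRep hφ.pair 0 (hφ.leftMul (b 0)) +
      rightRep hφ.pair 1 (hφ.leftMul (b 1))) ^ m) x) =
      (hφ.rightSum b ^ m) (freeProductVal hφ.pair x) := by
    intro m
    induction m with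
    | zero => intro x; rfl
    | succ m ih =>
      intro x
      rw [pow_succ, pow_succ, Module.End.mul_apply, Module.End.mul_apply, ih]
      rfl
  have h2 := hl m ((((rightRep hφ.pair 0 (hφ.leftMul (b 0)) +
      rightRep hφ.pair 1 (hφ.leftMul (b 1))) ^ n) (freeProduct hφ.pair).ξ))
  rw [hr n] at h2
  exact congrArg (vacuum hφ.pair) h2

end SumMoments

end BiFreeProb

end
noncomputable section

namespace BiFreeProb

open Filter

/-! ### The right action on alternating words -/

section AlternatingWords

variable {E : Fin 2 → PointedSpace.{v}}

/-- The alternating word of length `n` in the letters `k 0`, `k 1` that ends with `k i`. -/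
def altWord (k : ∀ i, (E i).Ker) : ℕ → Fin 2 → List (Σ i, (E i).Ker)
  | 0, _ => []
  | n + 1, i => altWord k n (i + 1) ++ [⟨i, k i⟩]

theorem wordTensor_append_singleton (l : List (Σ i, (E i).Ker)) (i : Fin 2) (x : (E i).Ker) :
    wordTensor E (l ++ [⟨i, x⟩]) = wordTensor E l * letter E i x := by
  rw [wordTensor_append, wordTensor_cons, wordTensor_nil, mul_one]

theorem rightOp_wordTensor_append (i : Fin 2) (T : Module.End ℂ (E i).carrier)
    (l : List (Σ i, (E i).Ker)) (x : (E i).Ker) :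
    rightOp E i T (wordTensor E (l ++ [⟨i, x⟩])) =
      (E i).ψ (T x) • wordTensor E l + wordTensor E l * letter E i ((E i).toKer (T x)) := by
  rw [rightOp, LinearMap.comp_apply, LinearMap.comp_apply, reversal_wordTensor,
    List.reverse_append, List.reverse_singleton, List.singleton_append, wordTensor_cons,
    leftOp_letter_mul, insert_wordTensor, map_add, map_smul, reversal_wordTensor,
    reversal_wordTensor, List.reverse_cons, List.reverse_reverse, wordTensor_append_singleton]

theorem rightOp_altWord (k : ∀ i, (E i).Ker) (n : ℕ) (i : Fin 2)
    (T : Module.End ℂ (E i).carrier) :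
    rightOp E i T (wordTensor E (altWord k n (i + 1))) =
      (E i).ψ (T (E i).ξ) • wordTensor E (altWord k n (i + 1)) +
        wordTensor E (altWord k n (i + 1)) * letter E i ((E i).toKer (T (E i).ξ)) := by
  rw [rightOp, LinearMap.comp_apply, LinearMap.comp_apply, reversal_wordTensor]
  have h : leftOp E i T (wordTensor E (altWord k n (i + 1)).reverse) =
      insert E i (T (E i).ξ) (wordTensor E (altWord k n (i + 1)).reverse) := by
    cases n with
    | zero => exact leftOp_one i T
    | succ n =>
      rw [altWord, List.reverse_append, List.reverse_singleton, List.singleton_append,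
        wordTensor_cons, leftOp_letter_mul_of_ne (by fin_cases i <;> decide)]
  rw [h, insert_wordTensor, map_add, map_smul, reversal_wordTensor, reversal_wordTensor,
    List.reverse_cons, List.reverse_reverse, wordTensor_append_singleton]

/-- For a word `u` not ending in index `i`, the argument is `u ⊗ (ξ_i + k_i)`, and the right action
applies `T` to that last factor. -/
theorem rightOp_altWord_add {k : ∀ i, (E i).Ker} (n : ℕ) {i : Fin 2}
    {T : Module.End ℂ (E i).carrier} {q r : ℂ}
    (hT : T ((E i).ξ + k i) = r • (E i).ξ + (q + r) • (k i : (E i).carrier)) :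
    rightOp E i T (wordTensor E (altWord k n (i + 1)) + wordTensor E (altWord k (n + 1) i)) =
      r • wordTensor E (altWord k n (i + 1)) + (q + r) • wordTensor E (altWord k (n + 1) i) := by
  have hk : (E i).ψ (k i) = 0 := (k i).2
  have h1 : (E i).ψ (T (E i).ξ) + (E i).ψ (T (k i)) = r := by
    rw [← map_add, ← map_add, hT, map_add, map_smul, map_smul, hk, (E i).ψ_ξ]
    simp
  have h2 : (E i).toKer (T (E i).ξ) + (E i).toKer (T (k i)) = (q + r) • k i := by
    rw [← map_add, ← map_add, hT]
    apply Subtype.ext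
    rw [coe_toKer, map_add, map_smul, map_smul, hk, (E i).ψ_ξ]
    simp
  rw [map_add, rightOp_altWord, altWord, rightOp_wordTensor_append, add_add_add_comm, ← add_smul,
    h1, ← mul_add, ← map_add, h2, map_smul, mul_smul_comm, wordTensor_append_singleton]

end AlternatingWords

/-! ### The resolvent of the right sum at the vacuum -/

section Series

variable {A : Type u} [CStarAlgebra A] {φ : A →ₗ[ℂ] ℂ} {hφ : IsState φ} {C C₀ : ℝ}
  {k : ∀ i, (hφ.pair i).Ker} {f : FullFock hφ.pair →ₗ[ℂ] ℂ}

theorem WordBound.norm_altWord_le (hf : WordBound hφ C C₀ f) (hC : 0 ≤ C)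
    (hk : ∀ i, C * hφ.letterNorm ⟨i, k i⟩ ≤ 1 / 2) (n : ℕ) (i : Fin 2) :
    ‖f (wordTensor hφ.pair (altWord k n i))‖ ≤ C₀ * (1 / 2) ^ n := by
  refine (hf _).trans (mul_le_mul_of_nonneg_left ?_ hf.nonneg)
  have h : ∀ (n : ℕ) (i : Fin 2),
      0 ≤ ((altWord k n i).map fun p => C * hφ.letterNorm p).prod ∧
      ((altWord k n i).map fun p => C * hφ.letterNorm p).prod ≤ (1 / 2) ^ n := by
    intro n
    induction n with
    | zero => intro i; simp [altWord]
    | succ n ih =>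
      intro i
      have h0 : 0 ≤ C * hφ.letterNorm ⟨i, k i⟩ := mul_nonneg hC (hφ.letterNorm_nonneg _)
      rw [altWord, List.map_append, List.prod_append, List.map_singleton, List.prod_singleton]
      refine ⟨mul_nonneg (ih _).1 h0, ?_⟩
      rw [pow_succ]
      exact mul_le_mul (ih _).2 (hk i) h0 (by positivity)
  exact (h n i).2

/-- The value of a functional on the sum of all nonempty alternating words that end with `k i`. -/
def altSeries (k : ∀ i, (hφ.pair i).Ker) (f : FullFock hφ.pair →ₗ[ℂ] ℂ) (i : Fin 2) : ℂ :=
  ∑' n, f (wordTensor hφ.pair (altWord k (n + 1) i))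

/-- The value of a functional on the sum of all alternating words in `k 0` and `k 1`. -/
def altValue (k : ∀ i, (hφ.pair i).Ker) (f : FullFock hφ.pair →ₗ[ℂ] ℂ) : ℂ :=
  f 1 + (altSeries k f 0 + altSeries k f 1)

theorem WordBound.summable_altWord (hf : WordBound hφ C C₀ f) (hC : 0 ≤ C)
    (hk : ∀ i, C * hφ.letterNorm ⟨i, k i⟩ ≤ 1 / 2) (i : Fin 2) :
    Summable fun n => f (wordTensor hφ.pair (altWord k n i)) :=
  Summable.of_norm_bounded (summable_geometric_two.mul_left C₀)
    fun n => hf.norm_altWord_le hC hk n i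

theorem WordBound.hasSum_altSeries (hf : WordBound hφ C C₀ f) (hC : 0 ≤ C)
    (hk : ∀ i, C * hφ.letterNorm ⟨i, k i⟩ ≤ 1 / 2) (i : Fin 2) :
    HasSum (fun n => f (wordTensor hφ.pair (altWord k (n + 1) i))) (altSeries k f i) :=
  ((summable_nat_add_iff 1).mpr (hf.summable_altWord hC hk i)).hasSum

theorem WordBound.hasSum_altWord (hf : WordBound hφ C C₀ f) (hC : 0 ≤ C)
    (hk : ∀ i, C * hφ.letterNorm ⟨i, k i⟩ ≤ 1 / 2) (i : Fin 2) :
    HasSum (fun n => f (wordTensor hφ.pair (altWord k n i))) (f 1 + altSeries k f i) := by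
  rw [add_comm]
  have h := (hasSum_nat_add_iff (f := fun n => f (wordTensor hφ.pair (altWord k n i))) 1).mp
    (hf.hasSum_altSeries hC hk i)
  rwa [Finset.sum_range_one] at h

/-- Regroups the words as pairs `u`, `u ⊗ k_i` with `u` not ending in index `i`, as
`rightOp_altWord_add` requires; the grouping depends on `i`, the total does not. -/
theorem WordBound.hasSum_altValue (hf : WordBound hφ C C₀ f) (hC : 0 ≤ C)
    (hk : ∀ i, C * hφ.letterNorm ⟨i, k i⟩ ≤ 1 / 2) (i : Fin 2) :
    HasSum (fun n => f (wordTensor hφ.pair (altWord k n (i + 1)) +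
      wordTensor hφ.pair (altWord k (n + 1) i))) (altValue k f) := by
  have h := (hf.hasSum_altWord hC hk (i + 1)).add (hf.hasSum_altSeries hC hk i)
  have e : f 1 + altSeries k f (i + 1) + altSeries k f i = altValue k f := by
    fin_cases i
    · change f 1 + altSeries k f 1 + altSeries k f 0 = _
      rw [altValue]; ring
    · change f 1 + altSeries k f 0 + altSeries k f 1 = _
      rw [altValue]; ring
  rw [e] at h
  simpa only [map_add] using h

/-- Additivity in the functional needs convergence, since `altValue` is defined through infinite
sums. -/
theorem WordBound.altValue_add {C₁ : ℝ} {g : FullFock hφ.pair →ₗ[ℂ] ℂ} (hf : WordBound hφ C C₀ f)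
    (hg : WordBound hφ C C₁ g) (hC : 0 ≤ C) (hk : ∀ i, C * hφ.letterNorm ⟨i, k i⟩ ≤ 1 / 2) :
    altValue k (f + g) = altValue k f + altValue k g := by
  have h : ∀ i, altSeries k (f + g) i = altSeries k f i + altSeries k g i := fun i =>
    ((hf.add hg).hasSum_altSeries hC hk i).unique
      ((hf.hasSum_altSeries hC hk i).add (hg.hasSum_altSeries hC hk i))
  rw [altValue, h, h, altValue, altValue, LinearMap.add_apply]
  ring

theorem WordBound.norm_altValue_le (hf : WordBound hφ C C₀ f) (hC : 0 ≤ C)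
    (hk : ∀ i, C * hφ.letterNorm ⟨i, k i⟩ ≤ 1 / 2) : ‖altValue k f‖ ≤ C₀ * 3 := by
  have h1 : ‖f 1‖ ≤ C₀ := by simpa [wordTensor_nil] using hf []
  have h2 : ∀ i, ‖altSeries k f i‖ ≤ C₀ := by
    intro i
    refine tsum_of_norm_bounded (g := fun n : ℕ => C₀ * (1 / 2 / 2 ^ n)) ?_ fun n => ?_
    · simpa using (hasSum_geometric_two' 1).mul_left C₀
    · refine (hf.norm_altWord_le hC hk (n + 1) i).trans_eq ?_
      rw [pow_succ, one_div_pow]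
      ring
  refine (norm_add_le_of_le h1 (norm_add_le_of_le (h2 0) (h2 1))).trans_eq (by ring)

variable {B : ℝ} {b : Fin 2 → A} {q : ℂ} {r : Fin 2 → ℂ}

theorem WordBound.altValue_comp_rightOp (hB0 : 1 ≤ B)
    (hB1 : ∀ x, ‖φ x‖ ≤ B * ‖x‖) (hB2 : ∀ x, ‖x - φ x • 1‖ ≤ B * ‖x‖) (hC : 1 ≤ C)
    (hk : ∀ i, C * hφ.letterNorm ⟨i, k i⟩ ≤ 1 / 2)
    (hb : ∀ i, b i * (1 + (k i : A)) = r i • (1 : A) + (q + r i) • (k i : A))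
    (hf : WordBound hφ C C₀ f) (i : Fin 2) :
    altValue k (f ∘ₗ rightOp hφ.pair i (hφ.leftMul (b i))) =
      r i * altValue k f + q * altSeries k f i := by
  have hC' : 0 ≤ C := by linarith
  have h1 := (hf.comp_rightOp hB0 hB1 hB2 hC i (b i)).hasSum_altValue hC' hk i
  have h2 := ((hf.hasSum_altValue hC' hk i).mul_left (r i)).add
    ((hf.hasSum_altSeries hC' hk i).mul_left q)
  refine h1.unique (h2.congr_fun ?_)
  intro n
  rw [LinearMap.comp_apply, rightOp_altWord_add n (hb i)]
  simp only [map_add, map_smul, smul_eq_mul]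
  ring

/-- Tested against `f`, this is the resolvent equation `(q + r 0 + r 1 - rightSum) Ω = q 1` for the
sum `Ω` of all alternating words: the words ending in index `0` or `1` make up `Ω - 1`. -/
theorem WordBound.altValue_comp_rightSum (hB0 : 1 ≤ B)
    (hB1 : ∀ x, ‖φ x‖ ≤ B * ‖x‖) (hB2 : ∀ x, ‖x - φ x • 1‖ ≤ B * ‖x‖) (hC : 1 ≤ C)
    (hk : ∀ i, C * hφ.letterNorm ⟨i, k i⟩ ≤ 1 / 2)
    (hb : ∀ i, b i * (1 + (k i : A)) = r i • (1 : A) + (q + r i) • (k i : A))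
    (hf : WordBound hφ C C₀ f) :
    altValue k (f ∘ₗ hφ.rightSum b) = (q + (r 0 + r 1)) * altValue k f - q * f 1 := by
  rw [IsState.rightSum, LinearMap.comp_add,
    (hf.comp_rightOp hB0 hB1 hB2 hC 0 (b 0)).altValue_add (hf.comp_rightOp hB0 hB1 hB2 hC 1 (b 1))
      (by linarith) hk, hf.altValue_comp_rightOp hB0 hB1 hB2 hC hk hb 0,
    hf.altValue_comp_rightOp hB0 hB1 hB2 hC hk hb 1]
  have e : f 1 = altValue k f - (altSeries k f 0 + altSeries k f 1) := by rw [altValue]; ring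
  rw [e]
  ring

/-- A telescoping series. -/
theorem hasSum_of_telescope {F G : ℕ → ℂ} {K q : ℂ} {M D : ℝ} (hq : q ≠ 0) (hM : 0 ≤ M)
    (hK : M < ‖K‖) (hG : ∀ n, G (n + 1) = K * G n - q * F n) (hFb : ∀ n, ‖F n‖ ≤ D * M ^ n)
    (hGb : ∀ n, ‖G n‖ ≤ D * M ^ n) :
    HasSum (fun n => F n / K ^ (n + 1)) (G 0 / q) := by
  have hK0 : K ≠ 0 := norm_pos_iff.mp (hM.trans_lt hK)
  have hKp : 0 < ‖K‖ := norm_pos_iff.mpr hK0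
  have hρ : M / ‖K‖ < 1 := (div_lt_one hKp).mpr hK
  have hρ0 : 0 ≤ M / ‖K‖ := div_nonneg hM hKp.le
  have hsum : Summable fun n => F n / K ^ (n + 1) := by
    refine Summable.of_norm_bounded ((summable_geometric_of_lt_one hρ0 hρ).mul_left (D / ‖K‖))
      fun n => ?_
    rw [norm_div, norm_pow, div_pow, div_mul_div_comm, ← pow_succ']
    exact div_le_div_of_nonneg_right (hFb n) (by positivity)
  rw [hsum.hasSum_iff_tendsto_nat]
  -- The recursion reads `F n / K ^ (n + 1) = (G n / K ^ n - G (n + 1) / K ^ (n + 1)) / q`.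
  have hpart : ∀ n, ∑ i ∈ Finset.range n, F i / K ^ (i + 1) = G 0 / q - G n / K ^ n / q := by
    intro n
    induction n with
    | zero => simp
    | succ n ih =>
      rw [Finset.sum_range_succ, ih, hG]
      field_simp
      ring
  simp only [hpart]
  have hlim : Tendsto (fun n => G n / K ^ n) atTop (𝓝 0) := by
    refine squeeze_zero_norm (a := fun n => D * (M / ‖K‖) ^ n) (fun n => ?_) ?_
    · rw [norm_div, norm_pow, div_pow, mul_div_assoc']
      exact div_le_div_of_nonneg_right (hGb n) (by positivity)
    · simpa using (tendsto_pow_atTop_nhds_zero_of_lt_one hρ0 hρ).const_mul D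
  simpa using (hlim.div_const q).const_sub (G 0 / q)

/-- Iterating the resolvent equation sums the Neumann series of the right sum at the vacuum, without
inverting an operator on the algebraic tensor space. -/
theorem WordBound.hasSum_rightSum_pow (hB0 : 1 ≤ B)
    (hB1 : ∀ x, ‖φ x‖ ≤ B * ‖x‖) (hB2 : ∀ x, ‖x - φ x • 1‖ ≤ B * ‖x‖) (hC : 1 ≤ C)
    (hk : ∀ i, C * hφ.letterNorm ⟨i, k i⟩ ≤ 1 / 2)
    (hb : ∀ i, b i * (1 + (k i : A)) = r i • (1 : A) + (q + r i) • (k i : A)) (hq : q ≠ 0)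
    (hK : B * (1 + C) * (‖b 0‖ + ‖b 1‖) < ‖q + (r 0 + r 1)‖) (hf : WordBound hφ C C₀ f) :
    HasSum (fun n => f ((hφ.rightSum b ^ n) 1) / (q + (r 0 + r 1)) ^ (n + 1))
      (altValue k f / q) := by
  have hM : 0 ≤ B * (1 + C) * (‖b 0‖ + ‖b 1‖) :=
    mul_nonneg (mul_nonneg (by linarith) (by linarith)) (by positivity)
  have hn := fun n => hf.comp_rightSum_pow hB0 hB1 hB2 hC b n
  have h := hasSum_of_telescope (F := fun n => f ((hφ.rightSum b ^ n) 1))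
    (G := fun n => altValue k (f ∘ₗ hφ.rightSum b ^ n)) (D := C₀ * 3) hq hM hK
    (fun n => ?_) (fun n => ?_) (fun n => ?_)
  · simpa [Module.End.one_eq_id] using h
  · rw [pow_succ, Module.End.mul_eq_comp, ← LinearMap.comp_assoc,
      (hn n).altValue_comp_rightSum hB0 hB1 hB2 hC hk hb]
    rfl
  · have h := hn n []
    rw [wordTensor_nil, List.map_nil, List.prod_nil, mul_one] at h
    refine h.trans (mul_le_mul_of_nonneg_right ?_ (pow_nonneg hM n))
    linarith [hf.nonneg]
  · refine ((hn n).norm_altValue_le (by linarith) hk).trans_eq ?_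
    ring

end Series

end BiFreeProb

end
noncomputable section

namespace BiFreeProb

open Filter

/-! ### The resolvent of the left sum, seen from the vacuum functional -/

section MultiplicativeFunctional

variable {A : Type u} [CStarAlgebra A] {φ : A →ₗ[ℂ] ℂ}

/-- The multiplicative functional on tensors which is `φ(N i * ·)` on the letters of index `i`. -/
def IsState.multFunctional (hφ : IsState φ) (N : Fin 2 → A) : FullFock hφ.pair →ₐ[ℂ] ℂ :=
  TensorAlgebra.lift ℂ
    (∑ i, φ ∘ₗ LinearMap.mulLeft ℂ (N i) ∘ₗ (hφ.pair i).Ker.subtype ∘ₗ LinearMap.proj i)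

variable {hφ : IsState φ} {N : Fin 2 → A}

theorem multFunctional_letter (i : Fin 2) (x : (hφ.pair i).Ker) :
    hφ.multFunctional N (letter hφ.pair i x) = φ (N i * (x : A)) := by
  simp only [IsState.multFunctional, letter, LinearMap.comp_apply, TensorAlgebra.lift_ι_apply,
    LinearMap.sum_apply]
  rw [Finset.sum_eq_single i]
  · simp
  · intro j _ hj
    simp [Pi.single_eq_of_ne hj]
  · simp

/-- The normalisation `φ(N i) = 1` makes the scalar part `φ(x)` and the centering correction cancel.
-/
theorem multFunctional_insert (hN : ∀ i, φ (N i) = 1) (i : Fin 2) (x : A)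
    (t : FullFock hφ.pair) :
    hφ.multFunctional N (insert hφ.pair i x t) = φ (N i * x) * hφ.multFunctional N t := by
  have h : ((hφ.pair i).toKer x : A) = x - φ x • 1 := rfl
  rw [insert_apply, map_add, map_smul, map_mul, multFunctional_letter, h, mul_sub, map_sub,
    mul_smul_comm, mul_one, map_smul, hN, smul_eq_mul, smul_eq_mul]
  change φ x * _ + _ = _
  ring

theorem wordBound_multFunctional {C : ℝ} (hC : ∀ i x, ‖φ (N i * x)‖ ≤ C * ‖x‖) :
    WordBound hφ C 1 (hφ.multFunctional N).toLinearMap := by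
  intro l
  rw [one_mul, AlgHom.toLinearMap_apply]
  induction l with
  | nil => rw [wordTensor_nil, map_one, norm_one, List.map_nil, List.prod_nil]
  | cons p l ih =>
    obtain ⟨i, x⟩ := p
    rw [wordTensor_cons, map_mul, multFunctional_letter, norm_mul, List.map_cons, List.prod_cons]
    exact mul_le_mul (hC i x) ih (norm_nonneg _) ((norm_nonneg _).trans (hC i x))

variable {a : Fin 2 → A} {q : ℂ} {r : Fin 2 → ℂ}

/-- The dual resolvent equation. A first letter `y` of index `i` has `φ(y) = 0`, so `a i` acts on it
as `q + r i` and the other element as `r j`. On the empty word only `r 0 + r 1` appears; the missing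
`q` is the vacuum term. -/
theorem multFunctional_leftSum (hN : ∀ i, φ (N i) = 1)
    (ha : ∀ i, N i * a i = (q + r i) • N i - q • 1) :
    ∀ t ∈ altTensors hφ.pair, hφ.multFunctional N (hφ.leftSum a t) =
      (q + (r 0 + r 1)) * hφ.multFunctional N t - q * vacuum hφ.pair t := by
  have h1 : ∀ i, φ (N i * a i) = r i := by
    intro i
    rw [ha, map_sub, map_smul, map_smul, hN, hφ.map_one]
    simp
  have hξ : ∀ i, hφ.leftMul (a i) hφ.pointedSpace.ξ = a i := fun i => mul_one (a i)
  have hhead : ∀ i (y : (hφ.pair i).Ker) (t : FullFock hφ.pair),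
      hφ.multFunctional N (leftOp hφ.pair i (hφ.leftMul (a i)) (letter hφ.pair i y * t)) =
      (q + r i) * hφ.multFunctional N (letter hφ.pair i y * t) := by
    intro i y t
    have hy : φ (y : A) = 0 := y.2
    have e : hφ.leftMul (a i) y = a i * (y : A) := rfl
    rw [leftOp_letter_mul, e, multFunctional_insert hN, ← mul_assoc, ha, sub_mul, map_sub,
      smul_mul_assoc, smul_mul_assoc, map_smul, map_smul, one_mul, hy,
      map_mul (hφ.multFunctional N), multFunctional_letter, smul_zero, sub_zero, smul_eq_mul]
    ring
  have hother : ∀ i j (y : (hφ.pair j).Ker) (t : FullFock hφ.pair), j ≠ i →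
      hφ.multFunctional N (leftOp hφ.pair i (hφ.leftMul (a i)) (letter hφ.pair j y * t)) =
      r i * hφ.multFunctional N (letter hφ.pair j y * t) := by
    intro i j y t hij
    rw [leftOp_letter_mul_of_ne hij, hξ, multFunctional_insert hN, h1]
  refine eq_of_eq_wordTensor (f := (hφ.multFunctional N).toLinearMap ∘ₗ hφ.leftSum a)
    (g := (q + (r 0 + r 1)) • (hφ.multFunctional N).toLinearMap - q • vacuum hφ.pair) fun l => ?_
  simp only [LinearMap.comp_apply, LinearMap.sub_apply, LinearMap.smul_apply,
    AlgHom.toLinearMap_apply, IsState.leftSum, LinearMap.add_apply, map_add, smul_eq_mul]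
  cases l with
  | nil =>
    rw [wordTensor_nil, leftOp_one, leftOp_one, hξ, hξ, multFunctional_insert hN,
      multFunctional_insert hN, h1, h1, map_one, vacuum_one]
    ring
  | cons p l =>
    obtain ⟨j, y⟩ := p
    rw [wordTensor_cons, vacuum_letter_mul, mul_zero, sub_zero]
    have hj : j = 0 ∨ j = 1 := by fin_cases j <;> simp
    obtain rfl | rfl := hj
    · rw [hhead, hother _ _ _ _ zero_ne_one]
      ring
    · rw [hhead, hother _ _ _ _ one_ne_zero]
      ring

theorem leftSum_pow_mem (n : ℕ) {t : FullFock hφ.pair} (ht : t ∈ altTensors hφ.pair) :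
    (hφ.leftSum a ^ n) t ∈ altTensors hφ.pair := by
  induction n with
  | zero => exact ht
  | succ n ih =>
    rw [pow_succ', Module.End.mul_apply]
    exact add_mem (leftOp_mem _ _ _ ih) (leftOp_mem _ _ _ ih)

theorem rightSum_pow_mem (b : Fin 2 → A) (n : ℕ) {t : FullFock hφ.pair}
    (ht : t ∈ altTensors hφ.pair) : (hφ.rightSum b ^ n) t ∈ altTensors hφ.pair := by
  induction n with
  | zero => exact ht
  | succ n ih =>
    rw [pow_succ', Module.End.mul_apply]
    exact add_mem (rightOp_mem _ _ _ ih) (rightOp_mem _ _ _ ih)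

theorem hasSum_leftSum_pow {B C : ℝ} (hB0 : 1 ≤ B)
    (hB1 : ∀ x, ‖φ x‖ ≤ B * ‖x‖) (hB2 : ∀ x, ‖x - φ x • 1‖ ≤ B * ‖x‖) (hC : 1 ≤ C)
    (hCN : ∀ i x, ‖φ (N i * x)‖ ≤ C * ‖x‖) (hN : ∀ i, φ (N i) = 1)
    (ha : ∀ i, N i * a i = (q + r i) • N i - q • 1) (hq : q ≠ 0)
    (hK : B * (1 + C) * (‖a 0‖ + ‖a 1‖) < ‖q + (r 0 + r 1)‖) (b : Fin 2 → A) (n : ℕ) :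
    HasSum (fun m => vacuum hφ.pair ((hφ.leftSum a ^ m) ((hφ.rightSum b ^ n) 1)) /
        (q + (r 0 + r 1)) ^ (m + 1))
      (hφ.multFunctional N ((hφ.rightSum b ^ n) 1) / q) := by
  have hM : 0 ≤ B * (1 + C) * (‖a 0‖ + ‖a 1‖) :=
    mul_nonneg (mul_nonneg (by linarith) (by linarith)) (by positivity)
  have hmem : (hφ.rightSum b ^ n) 1 ∈ altTensors hφ.pair :=
    rightSum_pow_mem b n (wordTensor_mem (l := []) List.isChain_nil)
  have hbound : ∀ {f : FullFock hφ.pair →ₗ[ℂ] ℂ}, WordBound hφ C 1 f → ∀ m,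
      ‖f ((hφ.leftSum a ^ m) ((hφ.rightSum b ^ n) 1))‖ ≤
        (B * (1 + C) * (‖b 0‖ + ‖b 1‖)) ^ n * (B * (1 + C) * (‖a 0‖ + ‖a 1‖)) ^ m := by
    intro f hf m
    have h := (hf.comp_leftSum_pow hB0 hB1 hB2 hC a m).comp_rightSum_pow hB0 hB1 hB2 hC b n []
    rw [wordTensor_nil, List.map_nil, List.prod_nil, mul_one, one_mul, mul_comm] at h
    exact h
  have h := hasSum_of_telescope
    (F := fun m => vacuum hφ.pair ((hφ.leftSum a ^ m) ((hφ.rightSum b ^ n) 1)))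
    (G := fun m => hφ.multFunctional N ((hφ.leftSum a ^ m) ((hφ.rightSum b ^ n) 1)))
    hq hM hK (fun m => ?_) (hbound (WordBound.vacuum hφ (by linarith)))
    (hbound (wordBound_multFunctional hCN))
  · simpa using h
  · rw [pow_succ', Module.End.mul_apply,
      multFunctional_leftSum hN ha _ (leftSum_pow_mem m hmem)]

/-- The sum of all alternating products of two numbers, in closed form. -/
theorem altValue_multFunctional {C C₀ : ℝ} {k : ∀ i, (hφ.pair i).Ker}
    (hb : WordBound hφ C C₀ (hφ.multFunctional N).toLinearMap) (hC : 0 ≤ C)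
    (hk : ∀ i, C * hφ.letterNorm ⟨i, k i⟩ ≤ 1 / 2) :
    altValue k (hφ.multFunctional N).toLinearMap *
      (1 - φ (N 0 * (k 0 : A)) * φ (N 1 * (k 1 : A))) =
      (1 + φ (N 0 * (k 0 : A))) * (1 + φ (N 1 * (k 1 : A))) := by
  -- Removing the last letter leaves the empty word or one ending in the other index; the two
  -- resulting linear equations give the closed form.
  have h : ∀ i, altSeries k (hφ.multFunctional N).toLinearMap i =
      (1 + altSeries k (hφ.multFunctional N).toLinearMap (i + 1)) * φ (N i * (k i : A)) := by
    intro i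
    have h1 := (hb.hasSum_altWord hC hk (i + 1)).mul_right (φ (N i * (k i : A)))
    refine (hb.hasSum_altSeries hC hk i).unique ?_
    rw [AlgHom.toLinearMap_apply, map_one] at h1
    refine h1.congr_fun fun n => ?_
    rw [altWord, wordTensor_append_singleton, AlgHom.toLinearMap_apply, AlgHom.toLinearMap_apply,
      map_mul, multFunctional_letter]
  have h0 := h 0
  have h1 := h 1
  rw [show (0 : Fin 2) + 1 = 1 from rfl] at h0
  rw [show (1 : Fin 2) + 1 = 0 from rfl] at h1
  rw [altValue, AlgHom.toLinearMap_apply, map_one]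
  linear_combination h0 + h1 + φ (N 0 * (k 0 : A)) * h1 + φ (N 1 * (k 1 : A)) * h0

end MultiplicativeFunctional

end BiFreeProb

end
noncomputable section

namespace BiFreeProb

open Filter

/-! ### Cauchy transforms of sums of bi-free pairs -/

section Additivity

variable {A : Type u} [CStarAlgebra A] {φ : A →ₗ[ℂ] ℂ}

theorem hasSum_resolvent {a : A} {K : ℂ} (hK0 : K ≠ 0) (hK : ‖a‖ < ‖K‖) :
    K ∈ resolventSet ℂ a ∧ HasSum (fun n : ℕ => (K ^ (n + 1))⁻¹ • a ^ n) (resolvent a K) := by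
  have hlt : ‖K⁻¹ • a‖ < 1 := by
    rw [norm_smul, norm_inv, inv_mul_lt_one₀ (norm_pos_iff.mpr hK0)]
    exact hK
  have hK1 : (K⁻¹)⁻¹ + 0 = K := by rw [inv_inv, add_zero]
  have he : (1 : A) + K⁻¹ • (algebraMap ℂ A 0 - a) = 1 - K⁻¹ • a := by
    rw [map_zero, zero_sub, smul_neg, sub_eq_add_neg]
  have h1 : IsUnit (1 - K⁻¹ • a) := (Units.oneSub _ hlt).isUnit
  refine ⟨?_, ?_⟩
  · rw [← hK1, mem_resolventSet_inv_add (inv_ne_zero hK0), he]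
    exact h1
  · have h2 := resolvent_inv_add (A := A) (inv_ne_zero hK0) (r := 0) (a := a)
    rw [hK1, he, NormedRing.inverse_one_sub _ hlt] at h2
    rw [h2]
    have h3 : HasSum (fun n : ℕ => (K⁻¹ • a) ^ n) ((Units.oneSub (K⁻¹ • a) hlt)⁻¹ : Aˣ) :=
      (summable_geometric_of_norm_lt_one hlt).hasSum
    refine (h3.const_smul K⁻¹).congr_fun fun n => ?_
    rw [smul_pow, smul_smul, pow_succ', mul_inv, inv_pow]

theorem hasSum_cauchy (hφ : IsState φ) {a : A} {K : ℂ} (hK0 : K ≠ 0) (hK : ‖a‖ < ‖K‖) (x : A) :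
    HasSum (fun n : ℕ => φ (a ^ n * x) / K ^ (n + 1)) (φ (resolvent a K * x)) := by
  have h := ((hasSum_resolvent hK0 hK).2.mul_right x).map φ hφ.continuous
  refine h.congr_fun fun n => ?_
  rw [Function.comp_apply, smul_mul_assoc, map_smul, smul_eq_mul, div_eq_inv_mul]

theorem hasSum_biCauchy (hφ : IsState φ) {b : A} {K : ℂ} (hK0 : K ≠ 0) (hK : ‖b‖ < ‖K‖) (x : A) :
    HasSum (fun n : ℕ => φ (x * b ^ n) / K ^ (n + 1)) (φ (x * resolvent b K)) := by
  have h := ((hasSum_resolvent hK0 hK).2.mul_left x).map φ hφ.continuous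
  refine h.congr_fun fun n => ?_
  rw [Function.comp_apply, mul_smul_comm, map_smul, smul_eq_mul, div_eq_inv_mul]

/-- Cauchy transforms of the sums of bi-free pairs, in terms of the resolvent elements
`N i = q (K i - a i)⁻¹` and `1 + k i = q' (K' i - b i)⁻¹` of expectation `1`. -/
theorem BiFree.cauchy_sum {hφ : IsState φ} {a b : Fin 2 → A} (h : BiFree.{u, v} φ a b)
    {B C : ℝ} (hB0 : 1 ≤ B) (hB1 : ∀ x, ‖φ x‖ ≤ B * ‖x‖) (hB2 : ∀ x, ‖x - φ x • 1‖ ≤ B * ‖x‖)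
    (hC : 1 ≤ C) {N : Fin 2 → A} {k : ∀ i, (hφ.pair i).Ker} {q q' : ℂ} {r r' : Fin 2 → ℂ}
    (hCN : ∀ i x, ‖φ (N i * x)‖ ≤ C * ‖x‖) (hN : ∀ i, φ (N i) = 1)
    (hk : ∀ i, C * hφ.letterNorm ⟨i, k i⟩ ≤ 1 / 2)
    (ha : ∀ i, N i * a i = (q + r i) • N i - q • 1)
    (hb : ∀ i, b i * (1 + (k i : A)) = r' i • (1 : A) + (q' + r' i) • (k i : A))
    (hq : q ≠ 0) (hq' : q' ≠ 0)
    (hK : B * (1 + C) * (‖a 0‖ + ‖a 1‖) < ‖q + (r 0 + r 1)‖)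
    (hK' : B * (1 + C) * (‖b 0‖ + ‖b 1‖) < ‖q' + (r' 0 + r' 1)‖) :
    (q + (r 0 + r 1) ∈ resolventSet ℂ (a 0 + a 1) ∧
      cauchy φ (a 0 + a 1) (q + (r 0 + r 1)) = q⁻¹) ∧
    (q' + (r' 0 + r' 1) ∈ resolventSet ℂ (b 0 + b 1) ∧
      cauchy φ (b 0 + b 1) (q' + (r' 0 + r' 1)) = q'⁻¹) ∧
    q * q' * biCauchy φ (a 0 + a 1) (b 0 + b 1) (q + (r 0 + r 1)) (q' + (r' 0 + r' 1)) *
      (1 - φ (N 0 * (k 0 : A)) * φ (N 1 * (k 1 : A))) =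
      (1 + φ (N 0 * (k 0 : A))) * (1 + φ (N 1 * (k 1 : A))) := by
  have hC' : 0 ≤ C := by linarith
  have hM : ∀ c : Fin 2 → A, ‖c 0 + c 1‖ ≤ B * (1 + C) * (‖c 0‖ + ‖c 1‖) := by
    intro c
    refine (norm_add_le _ _).trans (le_mul_of_one_le_left (by positivity) ?_)
    nlinarith
  have hKa := (hM a).trans_lt hK
  have hKb := (hM b).trans_lt hK'
  have hKa0 : q + (r 0 + r 1) ≠ 0 := norm_pos_iff.mp ((norm_nonneg _).trans_lt hKa)
  have hKb0 : q' + (r' 0 + r' 1) ≠ 0 := norm_pos_iff.mp ((norm_nonneg _).trans_lt hKb)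
  -- The Neumann series in the left variable is summed first, with the power of the right variable
  -- fixed; `n = 0` gives the scalar transform of `a 0 + a 1`.
  have hleft : ∀ n, φ (resolvent (a 0 + a 1) (q + (r 0 + r 1)) * (b 0 + b 1) ^ n) =
      hφ.multFunctional N ((hφ.rightSum b ^ n) 1) / q := by
    intro n
    refine (hasSum_cauchy hφ hKa0 hKa _).unique ?_
    simp only [h.moment_sum_eq hφ]
    exact hasSum_leftSum_pow hB0 hB1 hB2 hC hCN hN ha hq hK b n
  have hell := wordBound_multFunctional (hφ := hφ) hCN
  refine ⟨⟨(hasSum_resolvent hKa0 hKa).1, ?_⟩, ⟨(hasSum_resolvent hKb0 hKb).1, ?_⟩, ?_⟩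
  · have h0 := hleft 0
    rw [pow_zero, pow_zero, mul_one, Module.End.one_apply, map_one, one_div] at h0
    exact h0
  · have h1 := (WordBound.vacuum hφ hC').hasSum_rightSum_pow hB0 hB1 hB2 hC hk hb hq' hK'
    have h2 := hasSum_cauchy hφ hKb0 hKb 1
    -- The vacuum functional sees only the empty word of `Ω`; this gives the scalar transform of `b
    -- 0 + b 1`.
    have h3 : altValue k (vacuum hφ.pair) = 1 := by
      have : ∀ i, altSeries k (vacuum hφ.pair) i = 0 := by
        intro i
        have h4 : ∀ n i, vacuum hφ.pair (wordTensor hφ.pair (altWord k (n + 1) i)) = 0 := by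
          intro n i
          obtain ⟨p, l, hl⟩ := List.exists_cons_of_ne_nil
            (show altWord k (n + 1) i ≠ [] by simp [altWord])
          rw [hl, wordTensor_cons, vacuum_letter_mul]
        simp [altSeries, h4]
      rw [altValue, this, this, vacuum_one]
      simp
    rw [h3, one_div] at h1
    rw [mul_one] at h2
    refine h2.unique (h1.congr_fun fun n => ?_)
    rw [mul_one]
    have h5 := h.moment_sum_eq hφ 0 n
    rw [pow_zero, pow_zero, one_mul, Module.End.one_apply] at h5
    rw [h5]
  · rw [← altValue_multFunctional hell hC' hk]
    congr 1
    -- Summing over `n` evaluates the multiplicative functional on the right resolvent vector.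
    have h1 := hell.hasSum_rightSum_pow hB0 hB1 hB2 hC hk hb hq' hK'
    have h2 := hasSum_biCauchy hφ hKb0 hKb
      (resolvent (a 0 + a 1) (q + (r 0 + r 1)))
    simp only [hleft] at h2
    have h3 := h2.mul_left q
    have h4 := h3.unique (h1.congr_fun fun n => by
      rw [AlgHom.toLinearMap_apply]
      field_simp)
    rw [biCauchy, mul_comm q q', mul_assoc, h4]
    field_simp

end Additivity

end BiFreeProb

end
noncomputable section

namespace BiFreeProb

open Filter

/-! ### Additivity of the scalar and bi-free transforms -/

section Conclusion

variable {A : Type u} [CStarAlgebra A] {φ : A →ₗ[ℂ] ℂ}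

theorem apply_inverse_of_cauchy_eq {a : A} {z r : ℂ} (hz : z ≠ 0)
    (hG : cauchy φ a (z⁻¹ + r) = z) :
    φ (Ring.inverse (1 + z • (algebraMap ℂ A r - a))) = 1 := by
  rw [cauchy, resolvent_inv_add hz, map_smul, smul_eq_mul] at hG
  exact mul_left_cancel₀ hz (hG.trans (mul_one z).symm)

theorem inverse_mul_eq {a : A} {z r : ℂ} (hz : z ≠ 0)
    (h : IsUnit (1 + z • (algebraMap ℂ A r - a))) :
    Ring.inverse (1 + z • (algebraMap ℂ A r - a)) * a =
      (z⁻¹ + r) • Ring.inverse (1 + z • (algebraMap ℂ A r - a)) - z⁻¹ • 1 := by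
  have h1 := congrArg (fun x => z⁻¹ • x) (Ring.inverse_mul_cancel _ h)
  simp only [← mul_smul_comm] at h1
  rw [← inv_add_sub_eq hz, mul_sub, Algebra.algebraMap_eq_smul_one (R := ℂ) (A := A) (z⁻¹ + r),
    mul_smul_comm, mul_one] at h1
  rw [← h1, sub_sub_cancel]

theorem mul_inverse_eq {a : A} {z r : ℂ} (hz : z ≠ 0)
    (h : IsUnit (1 + z • (algebraMap ℂ A r - a))) :
    a * Ring.inverse (1 + z • (algebraMap ℂ A r - a)) =
      (z⁻¹ + r) • Ring.inverse (1 + z • (algebraMap ℂ A r - a)) - z⁻¹ • 1 := by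
  have h1 := congrArg (fun x => z⁻¹ • x) (Ring.mul_inverse_cancel _ h)
  simp only [← smul_mul_assoc] at h1
  rw [← inv_add_sub_eq hz, sub_mul, Algebra.algebraMap_eq_smul_one (R := ℂ) (A := A) (z⁻¹ + r),
    smul_mul_assoc, one_mul] at h1
  rw [← h1, sub_sub_cancel]

theorem eventually_lt_norm_inv_add {ι : Type*} {l : Filter ι} {z s : ι → ℂ} {s₀ : ℂ}
    (hz : Tendsto z l (𝓝[≠] 0)) (hs : Tendsto s l (𝓝 s₀)) (M : ℝ) :
    ∀ᶠ i in l, M < ‖(z i)⁻¹ + s i‖ := by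
  have hz0 : Tendsto z l (𝓝 0) := hz.mono_right nhdsWithin_le_nhds
  have h1 : Tendsto (fun i => M * ‖z i‖) l (𝓝 0) := by simpa using hz0.norm.const_mul M
  have h2 : Tendsto (fun i => ‖1 + z i * s i‖) l (𝓝 1) := by
    simpa using ((hz0.mul hs).const_add 1).norm
  filter_upwards [h1.eventually_lt h2 one_pos, hz.eventually eventually_mem_nhdsWithin]
    with i hi hi0
  have hi0' : z i ≠ 0 := hi0
  have e : (z i)⁻¹ + s i = (1 + z i * s i) / z i := by field_simp
  rw [e, norm_div, lt_div_iff₀ (norm_pos_iff.mpr hi0')]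
  exact hi

/-- Additivity of the scalar transforms for bi-free pairs. -/
theorem BiFree.eventually_additive (hφ : IsState φ) {a b : Fin 2 → A}
    (h : BiFree.{u, v} φ a b) {Ra Rb : Fin 2 → ℂ → ℂ} (hRa : ∀ i, IsRTransform φ (a i) (Ra i))
    (hRb : ∀ i, IsRTransform φ (b i) (Rb i)) {ι : Type*} {l : Filter ι} {z w : ι → ℂ}
    (hz : Tendsto z l (𝓝[≠] 0)) (hw : Tendsto w l (𝓝[≠] 0)) :
    ∀ᶠ p in l,
      ((z p)⁻¹ + (Ra 0 (z p) + Ra 1 (z p)) ∈ resolventSet ℂ (a 0 + a 1) ∧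
        cauchy φ (a 0 + a 1) ((z p)⁻¹ + (Ra 0 (z p) + Ra 1 (z p))) = z p) ∧
      ((w p)⁻¹ + (Rb 0 (w p) + Rb 1 (w p)) ∈ resolventSet ℂ (b 0 + b 1) ∧
        cauchy φ (b 0 + b 1) ((w p)⁻¹ + (Rb 0 (w p) + Rb 1 (w p))) = w p) ∧
      ((∀ i, biCauchy φ (a i) (b i) ((z p)⁻¹ + Ra i (z p)) ((w p)⁻¹ + Rb i (w p)) ≠ 0) →
        1 / (z p * w p) - 1 / biCauchy φ (a 0 + a 1) (b 0 + b 1)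
            ((z p)⁻¹ + (Ra 0 (z p) + Ra 1 (z p))) ((w p)⁻¹ + (Rb 0 (w p) + Rb 1 (w p))) =
          (1 / (z p * w p) - 1 / biCauchy φ (a 0) (b 0)
            ((z p)⁻¹ + Ra 0 (z p)) ((w p)⁻¹ + Rb 0 (w p))) +
          (1 / (z p * w p) - 1 / biCauchy φ (a 1) (b 1)
            ((z p)⁻¹ + Ra 1 (z p)) ((w p)⁻¹ + Rb 1 (w p)))) := by
  obtain ⟨B, hB0, hB1, hB2⟩ := hφ.exists_bound
  -- Since `N i` tends to `1`, eventually `‖N i‖ < ‖1‖ + 1`, and this `C` bounds `x ↦ φ(N i x)`.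
  set C : ℝ := B * (‖(1 : A)‖ + 1) with hCdef
  have hC : 1 ≤ C := by
    have := norm_nonneg (1 : A)
    nlinarith
  have hz0 : Tendsto z l (𝓝 0) := hz.mono_right nhdsWithin_le_nhds
  have hw0 : Tendsto w l (𝓝 0) := hw.mono_right nhdsWithin_le_nhds
  have hRa0 : ∀ i, Tendsto (fun p => Ra i (z p)) l (𝓝 (Ra i 0)) := fun i =>
    (hRa i).analyticAt.continuousAt.tendsto.comp hz0
  have hRb0 : ∀ i, Tendsto (fun p => Rb i (w p)) l (𝓝 (Rb i 0)) := fun i =>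
    (hRb i).analyticAt.continuousAt.tendsto.comp hw0
  have hN : ∀ i, Tendsto (fun p => Ring.inverse (1 + z p • (algebraMap ℂ A (Ra i (z p)) - a i)))
      l (𝓝 1) := fun i => tendsto_inverse_one_add.comp (tendsto_smul_sub hz0 (hRa0 i) (a i))
  have hM : ∀ i, Tendsto (fun p => Ring.inverse (1 + w p • (algebraMap ℂ A (Rb i (w p)) - b i)))
      l (𝓝 1) := fun i => tendsto_inverse_one_add.comp (tendsto_smul_sub hw0 (hRb0 i) (b i))
  have ev1 : ∀ i, ∀ᶠ p in l,
      ‖Ring.inverse (1 + z p • (algebraMap ℂ A (Ra i (z p)) - a i))‖ < ‖(1 : A)‖ + 1 := fun i =>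
    (hN i).norm.eventually_lt_const (lt_add_one _)
  have ev2 : ∀ i, ∀ᶠ p in l,
      C * ‖Ring.inverse (1 + w p • (algebraMap ℂ A (Rb i (w p)) - b i)) - 1‖ < 1 / 2 := by
    intro i
    have h1 := (((hM i).sub_const 1).norm).const_mul C
    rw [sub_self, norm_zero, mul_zero] at h1
    exact h1.eventually_lt_const (by norm_num)
  filter_upwards [eventually_all.mpr ev1, eventually_all.mpr ev2,
    eventually_all.mpr fun i => hz.eventually (hRa i).inverse,
    eventually_all.mpr fun i => hw.eventually (hRb i).inverse,
    hz.eventually eventually_mem_nhdsWithin, hw.eventually eventually_mem_nhdsWithin,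
    eventually_lt_norm_inv_add hz ((hRa0 0).add (hRa0 1)) (B * (1 + C) * (‖a 0‖ + ‖a 1‖)),
    eventually_lt_norm_inv_add hw ((hRb0 0).add (hRb0 1)) (B * (1 + C) * (‖b 0‖ + ‖b 1‖))]
    with p k1 k2 k3 k4 hz1 hw1 k5 k6
  have hzp : z p ≠ 0 := hz1
  have hwp : w p ≠ 0 := hw1
  set N : Fin 2 → A := fun i => Ring.inverse (1 + z p • (algebraMap ℂ A (Ra i (z p)) - a i))
    with hNdef
  set M : Fin 2 → A := fun i => Ring.inverse (1 + w p • (algebraMap ℂ A (Rb i (w p)) - b i))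
    with hMdef
  have hN1 : ∀ i, φ (N i) = 1 := fun i => apply_inverse_of_cauchy_eq hzp (k3 i).2
  have hM1 : ∀ i, φ (M i) = 1 := fun i => apply_inverse_of_cauchy_eq hwp (k4 i).2
  -- Expectation `1` of `M i` is what puts `M i - 1` in the kernel; it is small because `M i` tends
  -- to `1`.
  let k : ∀ i, (hφ.pair i).Ker := fun i => ⟨M i - 1, by
    rw [LinearMap.mem_ker]
    exact (map_sub φ _ _).trans (by rw [hM1, hφ.map_one, sub_self])⟩
  have hkM : ∀ i, 1 + (k i : A) = M i := fun i => add_sub_cancel 1 (M i)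
  have hCN : ∀ i x, ‖φ (N i * x)‖ ≤ C * ‖x‖ := by
    intro i x
    calc ‖φ (N i * x)‖ ≤ B * ‖N i * x‖ := hB1 _
      _ ≤ B * (‖N i‖ * ‖x‖) := by gcongr; exact norm_mul_le _ _
      _ ≤ B * ((‖(1 : A)‖ + 1) * ‖x‖) := by
          have := (k1 i).le
          gcongr
      _ = C * ‖x‖ := by rw [hCdef]; ring
  obtain ⟨⟨c1, c2⟩, ⟨c3, c4⟩, c5⟩ := h.cauchy_sum hB0 hB1 hB2 hC (N := N) (k := k)
    (q := (z p)⁻¹) (q' := (w p)⁻¹) (r := fun i => Ra i (z p)) (r' := fun i => Rb i (w p))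
    hCN hN1 (fun i => (k2 i).le)
    (fun i => inverse_mul_eq hzp ((mem_resolventSet_inv_add hzp).mp (k3 i).1))
    (fun i => by
      have hk' : (k i : A) = M i - 1 := rfl
      rw [hkM, mul_inverse_eq hwp ((mem_resolventSet_inv_add hwp).mp (k4 i).1), hk',
        smul_sub _ (M i), add_smul (w p)⁻¹ (Rb i (w p)) (1 : A)]
      abel)
    (inv_ne_zero hzp) (inv_ne_zero hwp) k5 k6
  rw [inv_inv] at c2 c4
  refine ⟨⟨c1, c2⟩, ⟨c3, c4⟩, fun hne => ?_⟩
  have hG : ∀ i, biCauchy φ (a i) (b i) ((z p)⁻¹ + Ra i (z p)) ((w p)⁻¹ + Rb i (w p)) =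
      z p * w p * (1 + φ (N i * (k i : A))) := by
    intro i
    rw [biCauchy, resolvent_inv_add hzp, resolvent_inv_add hwp, smul_mul_smul_comm, map_smul,
      smul_eq_mul]
    congr 1
    rw [← hN1 i, ← map_add]
    congr 1
    change N i * M i = _
    rw [← hkM, mul_add, mul_one]
  have hD : ∀ i, 1 + φ (N i * (k i : A)) ≠ 0 := by
    intro i hi
    apply hne i
    rw [hG, hi, mul_zero]
  rw [hG, hG]
  generalize biCauchy φ (a 0 + a 1) (b 0 + b 1) _ _ = G at c5 ⊢
  have hD0 := hD 0
  have hD1 := hD 1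
  generalize φ (N 0 * (k 0 : A)) = d0 at c5 hD0 ⊢
  generalize φ (N 1 * (k 1 : A)) = d1 at c5 hD1 ⊢
  have hprod : (1 + d0) * (1 + d1) ≠ 0 := mul_ne_zero hD0 hD1
  -- Nonvanishing need not be estimated: by `c5` the product of this number with `G` and scalars is
  -- nonzero.
  have hE : 1 - d0 * d1 ≠ 0 := by
    intro h0
    rw [h0, mul_zero] at c5
    exact hprod c5.symm
  have hG' : G = z p * w p * ((1 + d0) * (1 + d1)) / (1 - d0 * d1) := by
    rw [← c5]
    field_simp
  rw [hG']
  field_simp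
  ring

end Conclusion

end BiFreeProb

end
noncomputable section

namespace BiFreeProb

open Filter

/-! ### The two parts of the theorem -/

section Main

variable {A : Type u} [CStarAlgebra A] {φ : A →ₗ[ℂ] ℂ}

theorem IsMatRTransformOn.upper_eq (hφ : IsState φ) {a b : A} {Ra Rb : ℂ → ℂ} {Rab : ℂ → ℂ → ℂ}
    {Ω : Set (Matrix (Fin 2) (Fin 2) ℂ)} {R : Matrix (Fin 2) (Fin 2) ℂ → Matrix (Fin 2) (Fin 2) ℂ}
    (hRa : IsRTransform φ a Ra) (hRb : IsRTransform φ b Rb) (hRab : IsBiRTransform φ a b Rab)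
    (hΩ : ContainsUpper Ω) (hR : IsMatRTransformOn φ !![a, 0; 0, b] Ω R) :
    ∃ ε > 0, ∀ z w ζ : ℂ, ‖z‖ < ε → ‖w‖ < ε → z ≠ 0 → w ≠ 0 →
      R !![z, ζ; 0, w] =
        !![Ra z, ζ / (z * w) * (Rab z w - z * Ra z - w * Rb w); 0, Rb w] := by
  obtain ⟨ε, hε, H⟩ := hR.upper hφ hRa hRb hΩ
  -- The bi-free transform carries its own representatives of the scalar germs. Both choices
  -- describe the diagonal of the same matrix `R`, so they agree near `0`.
  obtain ⟨Ra', Rb', hRa', hRb', hf⟩ := hRab.formula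
  obtain ⟨ε', hε', H'⟩ := hR.upper hφ hRa' hRb' hΩ
  obtain ⟨δ, hδ, hf⟩ := Metric.eventually_nhds_iff.mp hf
  refine ⟨min ε (min ε' δ), lt_min hε (lt_min hε' hδ), fun z w ζ hz hw hz0 hw0 => ?_⟩
  rw [lt_min_iff, lt_min_iff] at hz hw
  have e := (H' z w ζ hz.2.1 hw.2.1 hz0 hw0).2
  have e' := (H z w ζ hz.1 hw.1 hz0 hw0).2
  have ha : Ra' z = Ra z := by
    have := congrFun (congrFun (e.symm.trans e') 0) 0
    simpa using this
  have hb : Rb' w = Rb w := by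
    have := congrFun (congrFun (e.symm.trans e') 1) 1
    simpa using this
  obtain ⟨-, hr⟩ := hf (y := (z, w)) (by
    rw [Prod.mk_zero_zero, dist_zero_right, Prod.norm_def]
    exact max_lt hz.2.2 hw.2.2) hz0 hw0
  rw [ha, hb] at hr
  dsimp only at hr
  rw [e', hr]
  congr! 4
  field_simp
  ring

theorem BiFree.isMatRTransformOn_add (hφ : IsState φ) {a b : Fin 2 → A}
    (h : BiFree.{u, v} φ a b) {Ω₁ Ω₂ Ω₃ : Set (Matrix (Fin 2) (Fin 2) ℂ)}
    {R₁ R₂ R₃ : Matrix (Fin 2) (Fin 2) ℂ → Matrix (Fin 2) (Fin 2) ℂ}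
    (hΩ₁ : ContainsUpper Ω₁) (hΩ₂ : ContainsUpper Ω₂) (hΩ₃ : ContainsUpper Ω₃)
    (h₁ : IsMatRTransformOn φ !![a 0, 0; 0, b 0] Ω₁ R₁)
    (h₂ : IsMatRTransformOn φ !![a 1, 0; 0, b 1] Ω₂ R₂)
    (h₃ : IsMatRTransformOn φ (!![a 0, 0; 0, b 0] + !![a 1, 0; 0, b 1]) Ω₃ R₃) :
    ∃ ε > 0, ∀ z w ζ : ℂ, ‖z‖ < ε → ‖w‖ < ε →
      R₃ !![z, ζ; 0, w] = R₁ !![z, ζ; 0, w] + R₂ !![z, ζ; 0, w] := by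
  have hX : (!![a 0, 0; 0, b 0] + !![a 1, 0; 0, b 1] : Matrix (Fin 2) (Fin 2) A) =
      !![a 0 + a 1, 0; 0, b 0 + b 1] := by
    ext i j
    fin_cases i <;> fin_cases j <;> simp
  rw [hX] at h₃
  choose Ra hRa using fun i => exists_isRTransform hφ (a i)
  choose Rb hRb using fun i => exists_isRTransform hφ (b i)
  have hid : Tendsto (fun z : ℂ => z) (𝓝[≠] 0) (𝓝[≠] 0) := tendsto_id
  -- The diagonal case `z = w` already shows that the sums of scalar R-transforms are R-transforms
  -- of the sums.
  have hadd := h.eventually_additive hφ hRa hRb hid hid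
  have hRa3 : IsRTransform φ (a 0 + a 1) (fun z => Ra 0 z + Ra 1 z) :=
    ⟨(hRa 0).analyticAt.add (hRa 1).analyticAt, hadd.mono fun z hz => hz.1⟩
  have hRb3 : IsRTransform φ (b 0 + b 1) (fun z => Rb 0 z + Rb 1 z) :=
    ⟨(hRb 0).analyticAt.add (hRb 1).analyticAt, hadd.mono fun z hz => hz.2.1⟩
  let S : Set (ℂ × ℂ) := {0}ᶜ ×ˢ {0}ᶜ
  have hz : Tendsto (fun p : ℂ × ℂ => p.1) (𝓝[S] 0) (𝓝[≠] 0) :=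
    tendsto_nhdsWithin_iff.mpr ⟨(continuous_fst.tendsto 0).mono_left nhdsWithin_le_nhds,
      eventually_mem_nhdsWithin.mono fun p hp => hp.1⟩
  have hw : Tendsto (fun p : ℂ × ℂ => p.2) (𝓝[S] 0) (𝓝[≠] 0) :=
    tendsto_nhdsWithin_iff.mpr ⟨(continuous_snd.tendsto 0).mono_left nhdsWithin_le_nhds,
      eventually_mem_nhdsWithin.mono fun p hp => hp.2⟩
  have hadd2 := h.eventually_additive hφ hRa hRb hz hw
  rw [eventually_nhdsWithin_iff] at hadd2
  obtain ⟨δ, hδ, hadd2⟩ := Metric.eventually_nhds_iff.mp hadd2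
  obtain ⟨ε₁, hε₁, H₁⟩ := h₁.upper hφ (hRa 0) (hRb 0) hΩ₁
  obtain ⟨ε₂, hε₂, H₂⟩ := h₂.upper hφ (hRa 1) (hRb 1) hΩ₂
  obtain ⟨ε₃, hε₃, H₃⟩ := h₃.upper hφ hRa3 hRb3 hΩ₃
  obtain ⟨δ₁, hδ₁, D₁⟩ := hΩ₁
  obtain ⟨δ₂, hδ₂, D₂⟩ := hΩ₂
  obtain ⟨δ₃, hδ₃, D₃⟩ := hΩ₃
  obtain ⟨ε, hε, hεle⟩ : ∃ ε > 0, ε ≤ δ ∧ ε ≤ ε₁ ∧ ε ≤ ε₂ ∧ ε ≤ ε₃ ∧ ε ≤ δ₁ ∧ ε ≤ δ₂ ∧ ε ≤ δ₃ :=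
    ⟨min δ (min ε₁ (min ε₂ (min ε₃ (min δ₁ (min δ₂ δ₃))))), by positivity, by simp⟩
  obtain ⟨i0, i1, i2, i3, i4, i5, i6⟩ := hεle
  have key : ∀ z w ζ : ℂ, ‖z‖ < ε → ‖w‖ < ε → z ≠ 0 → w ≠ 0 →
      R₃ !![z, ζ; 0, w] = R₁ !![z, ζ; 0, w] + R₂ !![z, ζ; 0, w] := by
    intro z w ζ hz hw hz0 hw0
    obtain ⟨g1, e1⟩ := H₁ z w ζ (hz.trans_le i1) (hw.trans_le i1) hz0 hw0
    obtain ⟨g2, e2⟩ := H₂ z w ζ (hz.trans_le i2) (hw.trans_le i2) hz0 hw0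
    obtain ⟨-, e3⟩ := H₃ z w ζ (hz.trans_le i3) (hw.trans_le i3) hz0 hw0
    have hd := (@hadd2 (z, w) (by
      rw [dist_zero_right, Prod.norm_def]
      exact max_lt (hz.trans_le i0) (hw.trans_le i0)) ⟨hz0, hw0⟩).2.2
      (fun i => by fin_cases i <;> assumption)
    dsimp only at hd
    rw [e1, e2, e3, hd]
    ext i j
    fin_cases i <;> fin_cases j <;> simp [mul_add]
  refine ⟨ε, hε, fun z w ζ hz hw => ?_⟩
  have hcont : ∀ {Ω : Set (Matrix (Fin 2) (Fin 2) ℂ)}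
      {R : Matrix (Fin 2) (Fin 2) ℂ → Matrix (Fin 2) (Fin 2) ℂ} {X : Matrix (Fin 2) (Fin 2) A},
      IsMatRTransformOn φ X Ω R → !![z, ζ; 0, w] ∈ Ω →
      Tendsto (fun p : ℂ × ℂ => R !![p.1, ζ; 0, p.2]) (𝓝[S] (z, w)) (𝓝 (R !![z, ζ; 0, w])) := by
    intro Ω R X hR hmem
    have h1 : ContinuousAt (fun p : ℂ × ℂ => (!![p.1, ζ; 0, p.2] : Matrix (Fin 2) (Fin 2) ℂ))
        (z, w) :=
      (analyticAt_upper analyticAt_fst analyticAt_const analyticAt_snd).continuousAt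
    exact (((hR.analytic _ hmem).continuousAt.tendsto).comp h1.tendsto).mono_left nhdsWithin_le_nhds
  -- The points with `z = 0` or `w = 0` are reached by continuity from the dense set where both are
  -- nonzero.
  have hdense : Dense S := (dense_compl_singleton (0 : ℂ)).prod (dense_compl_singleton (0 : ℂ))
  have : (𝓝[S] (z, w)).NeBot := mem_closure_iff_nhdsWithin_neBot.mp (hdense (z, w))
  refine tendsto_nhds_unique_of_eventuallyEq
    (hcont h₃ (D₃ z w ζ (hz.trans_le i6) (hw.trans_le i6)))
    ((hcont h₁ (D₁ z w ζ (hz.trans_le i4) (hw.trans_le i4))).add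
      (hcont h₂ (D₂ z w ζ (hz.trans_le i5) (hw.trans_le i5)))) ?_
  have hn1 : ∀ᶠ p : ℂ × ℂ in 𝓝[S] (z, w), ‖p.1‖ < ε :=
    (continuous_fst.norm.tendsto (z, w)).mono_left nhdsWithin_le_nhds |>.eventually_lt_const hz
  have hn2 : ∀ᶠ p : ℂ × ℂ in 𝓝[S] (z, w), ‖p.2‖ < ε :=
    (continuous_snd.norm.tendsto (z, w)).mono_left nhdsWithin_le_nhds |>.eventually_lt_const hw
  filter_upwards [hn1, hn2, eventually_mem_nhdsWithin] with p hp1 hp2 hp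
  exact key p.1 p.2 ζ hp1 hp2 hp.1 hp.2

end Main

end BiFreeProb

end

theorem mainTheorem11 {A : Type u} [CStarAlgebra A] (φ : A →ₗ[ℂ] ℂ)
    (hφ : BiFreeProb.IsState φ) :
    -- all the transforms exist
    (∀ a b : A,
      (∃ Ra : ℂ → ℂ, BiFreeProb.IsRTransform φ a Ra) ∧
      (∃ Rab : ℂ → ℂ → ℂ, BiFreeProb.IsBiRTransform φ a b Rab) ∧
      (∃ (Ω : Set (Matrix (Fin 2) (Fin 2) ℂ))
        (RX : Matrix (Fin 2) (Fin 2) ℂ → Matrix (Fin 2) (Fin 2) ℂ),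
        BiFreeProb.ContainsUpper Ω ∧
        BiFreeProb.IsMatRTransformOn φ !![a, 0; 0, b] Ω RX)) ∧
    -- the formula for the `R`-transform of `diag(a, b)`
    (∀ (a b : A) (Ra Rb : ℂ → ℂ) (Rab : ℂ → ℂ → ℂ) (Ω : Set (Matrix (Fin 2) (Fin 2) ℂ))
      (RX : Matrix (Fin 2) (Fin 2) ℂ → Matrix (Fin 2) (Fin 2) ℂ),
      BiFreeProb.IsRTransform φ a Ra →
      BiFreeProb.IsRTransform φ b Rb →
      BiFreeProb.IsBiRTransform φ a b Rab →
      BiFreeProb.ContainsUpper Ω →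
      BiFreeProb.IsMatRTransformOn φ !![a, 0; 0, b] Ω RX →
      ∃ ε > 0, ∀ z w ζ : ℂ, ‖z‖ < ε → ‖w‖ < ε → z ≠ 0 → w ≠ 0 →
        RX !![z, ζ; 0, w] =
          !![Ra z, ζ / (z * w) * (Rab z w - z * Ra z - w * Rb w); 0, Rb w]) ∧
    -- additivity for bi-free pairs
    (∀ a b : Fin 2 → A, BiFreeProb.BiFree.{u, v} φ a b →
      ∀ (Ω₁ Ω₂ Ω₃ : Set (Matrix (Fin 2) (Fin 2) ℂ))
        (R₁ R₂ R₃ : Matrix (Fin 2) (Fin 2) ℂ → Matrix (Fin 2) (Fin 2) ℂ),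
      BiFreeProb.ContainsUpper Ω₁ → BiFreeProb.ContainsUpper Ω₂ → BiFreeProb.ContainsUpper Ω₃ →
      BiFreeProb.IsMatRTransformOn φ !![a 0, 0; 0, b 0] Ω₁ R₁ →
      BiFreeProb.IsMatRTransformOn φ !![a 1, 0; 0, b 1] Ω₂ R₂ →
      BiFreeProb.IsMatRTransformOn φ (!![a 0, 0; 0, b 0] + !![a 1, 0; 0, b 1]) Ω₃ R₃ →
      ∃ ε > 0, ∀ z w ζ : ℂ, ‖z‖ < ε → ‖w‖ < ε →
        R₃ !![z, ζ; 0, w] = R₁ !![z, ζ; 0, w] + R₂ !![z, ζ; 0, w]) := by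
  refine ⟨fun a b => ⟨BiFreeProb.exists_isRTransform hφ a, BiFreeProb.exists_isBiRTransform hφ a b,
    BiFreeProb.exists_isMatRTransformOn hφ a b⟩, ?_, ?_⟩
  · intro a b Ra Rb Rab Ω RX hRa hRb hRab hΩ hRX
    exact BiFreeProb.IsMatRTransformOn.upper_eq hφ hRa hRb hRab hΩ hRX
  · intro a b h Ω₁ Ω₂ Ω₃ R₁ R₂ R₃ hΩ₁ hΩ₂ hΩ₃ h₁ h₂ h₃
    exact h.isMatRTransformOn_add hφ hΩ₁ hΩ₂ hΩ₃ h₁ h₂ h₃
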